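/- Let $d\ge 2$ be an integer and let $\gamma>d$ be real. Let $\mathcal L^d$ be the space of (unoriented) lines of $\mathbb R^d$ with the $\sigma$-algebra generated by the hitting sets $[K]=\{l: l\cap K\neq\emptyset\}$ of compact sets $K$, and let $\mu_d$ be the measure on $\mathcal L^d$ that is invariant under Euclidean isometries, normalized so that $\mu_d([K])=\tfrac12 m_{d-1}(\partial K)$ for every compact convex $K$ with non-empty interior; that is, $$\mu_d(A)=\frac{1}{2\,m_{d-1}(\mathbb B^{d-1})}\int_{\mathbb S^{d-1}} m_{d-1}\{p\in u^\perp : p+\mathbb R u\in A\}\,\mathrm d\sigma(u),$$ where $\sigma$ is the surface measure on the unit sphere $\mathbb S^{d-1}$, $\mathbb B^{d-1}$ is the unit ball of $\mathbb R^{d-1}$, and $m_k$ is $k$-dimensional Hausdorff measure. Let $\Pi$ be a Poisson point process of marked lines $(l,v)\in\mathcal L^d\times(0,\infty)$ with intensity measure $\mathrm d\mu_d(l)\,(\gamma-1)v^{-\gamma}\,\mathrm dv$ ($v$ is the speed limit of $l$). A finite-time $\Pi$-path is a locally Lipschitz map $\xi:[0,T]\to\mathbb R^d$, $0\le T<\infty$,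 such that for almost every $t\in[0,T]$ either $\xi'(t)=0$, or there is $v\ge|\xi'(t)|$ with $(\xi(t)+\mathbb R\,\xi'(t),v)\in\Pi$; its time length is $T$. A $\Pi$-geodesic from $x$ to $y$ is a finite-time $\Pi$-path with $\xi(0)=x$, $\xi(T)=y$ whose time length is minimal among all finite-time $\Pi$-paths from $x$ to $y$. The support of $\xi$ is the set of lines $l$ of $\Pi$ such that $m_1(l\cap\xi([0,T]))>0$. **Theorem.** For all fixed $x,y\in\mathbb R^d$, almost surely, all $\Pi$-geodesics from $x$ to $y$ have exactly the same support. -/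

import Mathlib

open MeasureTheory Set Metric

noncomputable section

namespace PoissonRoads

/-- The Euclidean space `ℝ^d`. -/
abbrev E (d : ℕ) : Type := EuclideanSpace ℝ (Fin d)

/-! ### The space of lines and its invariant measure -/

/-- An (un-sensed) line of `ℝ^d`: a one-dimensional affine subspace. -/
def Line (d : ℕ) : Type :=
  {l : AffineSubspace ℝ (E d) //
    (l : Set (E d)).Nonempty ∧ Module.finrank ℝ l.direction = 1}

/-- The set of points of a line. -/
def Line.points {d : ℕ} (l : Line d) : Set (E d) := (l.1 : Set (E d))

/-- The hitting set `[K]` of `K`: the set of all lines that intersect `K`. -/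
def hittingSet {d : ℕ} (K : Set (E d)) : Set (Line d) := {l | (l.points ∩ K).Nonempty}

/-- The space of lines carries the σ-algebra generated by the hitting sets of compact sets. -/
instance Line.instMeasurableSpace (d : ℕ) : MeasurableSpace (Line d) :=
  MeasurableSpace.generateFrom {S | ∃ K : Set (E d), IsCompact K ∧ S = hittingSet K}

/-- The line through the point `p` with direction the unit vector `u`. -/
def Line.through {d : ℕ} (u : sphere (0 : E d) 1) (p : E d) : Line d :=
  ⟨AffineSubspace.mk' p (Submodule.span ℝ {(u : E d)}),
    ⟨p, AffineSubspace.self_mem_mk' p _⟩, by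
      rw [AffineSubspace.direction_mk']
      exact finrank_span_singleton (ne_zero_of_mem_unit_sphere u)⟩

/-- The hyperplane through the origin orthogonal to the unit vector `u`. -/
abbrev normalHyperplane {d : ℕ} (u : sphere (0 : E d) 1) : Submodule ℝ (E d) :=
  (Submodule.span ℝ {(u : E d)})ᗮ

/-- The measure on lines of direction `u` obtained from the Lebesgue measure on the
hyperplane orthogonal to `u`, a point of which locates the line. -/
def parallelLineMeasure {d : ℕ} (u : sphere (0 : E d) 1) : Measure (Line d) :=
  (volume : Measure (normalHyperplane u)).map
    (fun p : normalHyperplane u => Line.through u (p : E d))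

/-- The invariant line measure `μ_d`, normalized so that the hitting set of a convex body `K` has
measure half the surface area of `K`. A direction is integrated over the unit sphere with its
surface measure, which counts every un-sensed direction twice (whence the factor `2`), and the
localization over the hyperplane orthogonal to it. -/
def lineMeasure (d : ℕ) : Measure (Line d) :=
  (2 * volume (ball (0 : E (d - 1)) 1))⁻¹ •
    ((volume : Measure (E d)).toSphere).bind parallelLineMeasure

theorem measurable_through (d : ℕ) :
    Measurable (fun q : sphere (0 : E d) 1 × E d => Line.through q.1 q.2) := by
  refine measurable_generateFrom ?_
  rintro S ⟨K, hK, rfl⟩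
  have hcl : IsClosed {q : K × (sphere (0 : E d) 1 × E d) |
      (q.1 : E d) - q.2.2
        = (inner ℝ (q.2.1 : E d) ((q.1 : E d) - q.2.2)) • (q.2.1 : E d)} := by
    refine isClosed_eq ?_ ?_ <;> fun_prop
  have : CompactSpace K := isCompact_iff_compactSpace.mp hK
  have h2 := isClosedMap_snd_of_compactSpace _ hcl
  convert h2.measurableSet using 1
  ext ⟨u, p⟩
  simp only [hittingSet, Line.points, Line.through, mem_ofPred_eq, mem_image,
    Prod.exists, Subtype.exists]
  constructor
  · rintro ⟨k, hk, hkK⟩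
    refine ⟨k, hkK, (u : E d), u.2, p, ?_, rfl⟩
    have hk' : k - p ∈ Submodule.span ℝ {(u : E d)} := by
      simpa [AffineSubspace.mem_mk'] using hk
    obtain ⟨c, hc⟩ := Submodule.mem_span_singleton.mp hk'
    have hu : ‖(u : E d)‖ = 1 := by simp
    simp only [← hc, inner_smul_right, real_inner_self_eq_norm_sq, hu]
    simp
  · rintro ⟨k, hkK, v, hv, q, h, heq⟩
    obtain ⟨h1, rfl⟩ := Prod.mk.injEq _ _ _ _ |>.mp heq
    subst h1
    refine ⟨k, ?_, hkK⟩
    have : k - q ∈ Submodule.span ℝ {v} := Submodule.mem_span_singleton.mpr ⟨_, h.symm⟩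
    simpa [AffineSubspace.mem_mk'] using this

theorem through_add_smul {d : ℕ} (u : sphere (0 : E d) 1) (p w : E d)
    (hw : w ∈ Submodule.span ℝ {(u : E d)}) :
    Line.through u (w + p) = Line.through u p := by
  refine Subtype.ext ?_
  refine AffineSubspace.ext_of_direction_eq (by simp [Line.through]) ⟨w + p, ?_, ?_⟩
  · exact AffineSubspace.self_mem_mk' _ _
  · simpa [Line.through, AffineSubspace.mem_mk'] using hw

theorem measurePreserving_add_orthogonal {F : Type*} [NormedAddCommGroup F]
    [InnerProductSpace ℝ F] [FiniteDimensional ℝ F] [MeasurableSpace F] [BorelSpace F]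
    (s : Submodule ℝ F) :
    MeasurePreserving (fun q : s × sᗮ => (q.1 : F) + (q.2 : F)) volume volume := by
  have h := (Submodule.measurePreserving_measurableEquivProd s (0 : F)).symm
  rw [InnerProductSpace.euclideanHausdorffMeasure_eq_volume] at h
  have heq : (fun q : s × sᗮ => (q.1 : F) + (q.2 : F)) = (s.measurableEquivProd (0 : F)).symm := by
    ext q
    simp
  rw [heq]
  exact h

theorem volume_slab {d : ℕ} (u : sphere (0 : E d) 1) {A : Set (Line d)}
    (hA : MeasurableSet A) :
    volume {x : E d | |inner ℝ (u : E d) x| ≤ 1 ∧ Line.through u x ∈ A}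
      = volume (closedBall (0 : Submodule.span ℝ {(u : E d)}) 1) * parallelLineMeasure u A := by
  have hthr0 : Measurable (fun p : E d => Line.through u p) :=
    Measurable.comp (f := fun p : E d => (u, p))
      (g := fun q : sphere (0 : E d) 1 × E d => Line.through q.1 q.2)
      (measurable_through d) measurable_prodMk_left
  have hthr : Measurable (fun p : normalHyperplane u => Line.through u (p : E d)) :=
    hthr0.comp (Measurable.subtype_val measurable_id)
  have hS : MeasurableSet {x : E d | |inner ℝ (u : E d) x| ≤ 1 ∧ Line.through u x ∈ A} := by
    have h1 : Measurable fun x : E d => |inner ℝ (u : E d) x| := by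
      have : Continuous fun x : E d => |inner ℝ (u : E d) x| := by fun_prop
      exact this.measurable
    have h2 := (measurableSet_le h1 (measurable_const (a := (1 : ℝ)))).inter
      (hthr0 hA)
    convert h2 using 1
    ext q
    rfl
  have hmp := measurePreserving_add_orthogonal (Submodule.span ℝ {(u : E d)})
  rw [parallelLineMeasure, Measure.map_apply hthr hA, ← Measure.prod_prod,
    ← Measure.volume_eq_prod, ← hmp.measure_preimage hS.nullMeasurableSet]
  congr 1
  ext ⟨w, p⟩
  have hu : ‖(u : E d)‖ = 1 := by simp
  have hw : |inner ℝ (u : E d) (w : E d)| = ‖w‖ := by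
    obtain ⟨a, ha⟩ := Submodule.mem_span_singleton.mp w.2
    have hn : ‖w‖ = ‖(w : E d)‖ := rfl
    rw [hn, ← ha, inner_smul_right, real_inner_self_eq_norm_sq, norm_smul, hu]
    simp
  have hp : inner ℝ (u : E d) (p : E d) = 0 :=
    p.2 _ (Submodule.mem_span_singleton_self _)
  simp [inner_add_right, hp, hw, through_add_smul u (p : E d) (w : E d) w.2]

theorem volume_closedBall_span {d : ℕ} (u : sphere (0 : E d) 1) :
    volume (closedBall (0 : Submodule.span ℝ {(u : E d)}) 1) = 2 := by
  have hfin : Module.finrank ℝ (Submodule.span ℝ {(u : E d)}) = 1 :=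
    finrank_span_singleton (ne_zero_of_mem_unit_sphere u)
  have : Nontrivial (Submodule.span ℝ {(u : E d)}) :=
    Module.nontrivial_of_finrank_pos (R := ℝ) (by omega)
  have hpi : √Real.pi ≠ 0 := by have := Real.pi_pos; positivity
  have hG : Real.Gamma (1 / 2 + 1) = √Real.pi / 2 := by
    rw [Real.Gamma_add_one (by norm_num), Real.Gamma_one_half_eq]; ring
  rw [InnerProductSpace.volume_closedBall, hfin]
  simp only [Nat.cast_one, hG, pow_one, ENNReal.ofReal_one, one_mul]
  rw [div_div_cancel₀ hpi]
  norm_num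

/-- The measures `parallelLineMeasure u` depend measurably on `u`, so that the integral over
directions that defines `lineMeasure` is a genuine one. -/
theorem measurable_parallelLineMeasure (d : ℕ) :
    Measurable (parallelLineMeasure : sphere (0 : E d) 1 → Measure (Line d)) := by
  refine Measure.measurable_of_measurable_coe _ fun A hA => ?_
  have h1 : Measurable fun q : sphere (0 : E d) 1 × E d => |inner ℝ (q.1 : E d) q.2| := by
    have : Continuous fun q : sphere (0 : E d) 1 × E d => |inner ℝ (q.1 : E d) q.2| := by
      fun_prop
    exact this.measurable
  have hB : MeasurableSet {q : sphere (0 : E d) 1 × E d |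
      |inner ℝ (q.1 : E d) q.2| ≤ 1 ∧ Line.through q.1 q.2 ∈ A} := by
    have h2 := (measurableSet_le h1 (measurable_const (a := (1 : ℝ)))).inter
      (measurable_through d hA)
    convert h2 using 1
    ext q
    rfl
  have hmeas := measurable_measure_prodMk_left (ν := (volume : Measure (E d))) hB
  have key : ∀ u : sphere (0 : E d) 1, parallelLineMeasure u A
      = 2⁻¹ * volume (Prod.mk u ⁻¹' {q : sphere (0 : E d) 1 × E d |
        |inner ℝ (q.1 : E d) q.2| ≤ 1 ∧ Line.through q.1 q.2 ∈ A}) := by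
    intro u
    have h3 := volume_slab u hA
    rw [volume_closedBall_span] at h3
    have h4 : Prod.mk u ⁻¹' {q : sphere (0 : E d) 1 × E d |
        |inner ℝ (q.1 : E d) q.2| ≤ 1 ∧ Line.through q.1 q.2 ∈ A}
        = {x : E d | |inner ℝ (u : E d) x| ≤ 1 ∧ Line.through u x ∈ A} := rfl
    rw [h4, h3, ← mul_assoc, ENNReal.inv_mul_cancel (by norm_num) (by norm_num), one_mul]
  simp_rw [key]
  exact hmeas.const_mul _

/-! ### The improper Poisson line process -/

/-- The law of speeds: density `(γ - 1) v^{-γ}` on `(0, ∞)`. -/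
def speedMeasure (γ : ℝ) : Measure ℝ :=
  (volume.restrict (Ioi (0 : ℝ))).withDensity fun v => ENNReal.ofReal ((γ - 1) * v ^ (-γ))

/-- The intensity `μ_{d,γ}` of the marked lines `(l, v)`. -/
def markedLineMeasure (d : ℕ) (γ : ℝ) : Measure (Line d × ℝ) :=
  (lineMeasure d).prod (speedMeasure γ)

/-- The number of points in `B` of a random set of points `X`. -/
def count {Ω S : Type*} (X : Ω → Set S) (B : Set S) (ω : Ω) : ℕ∞ := (X ω ∩ B).encard

/-- The random set of points `X`, defined on the probability space `(Ω, P)`, is a Poisson point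
process with (atom-free) intensity measure `Λ`: the number of points in a measurable set `B` is a
Poisson variable with parameter `Λ B` (almost surely infinite if `Λ B = ∞`), and the numbers of
points in disjoint measurable sets are independent. -/
structure IsPoissonProcess {Ω S : Type*} [MeasurableSpace Ω] [MeasurableSpace S]
    (X : Ω → Set S) (Λ : Measure S) (P : Measure Ω) : Prop where
  measurable_count : ∀ B : Set S, MeasurableSet B → Measurable (count X B)
  map_count : ∀ B : Set S, MeasurableSet B → Λ B ≠ ⊤ →
    P.map (count X B) = (ProbabilityTheory.poissonMeasure (Λ B).toNNReal).map (fun n : ℕ => (n : ℕ∞))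
  count_eq_top : ∀ B : Set S, MeasurableSet B → Λ B = ⊤ → ∀ᵐ ω ∂P, count X B ω = ⊤
  indep : ∀ B : ℕ → Set S, (∀ i, MeasurableSet (B i)) → Pairwise (fun i j => Disjoint (B i) (B j)) →
    ProbabilityTheory.iIndepFun (fun i => count X (B i)) P

/-! ### Paths, geodesics, supports -/

/-- `ξ`, restricted to `[0, T]`, is a finite-time path respecting the speed limits given by the
set `M` of marked lines: it is locally Lipschitz and at almost every time it either
has speed zero or follows a line of `M` without exceeding its speed limit. -/
def IsPath {d : ℕ} (M : Set (Line d × ℝ)) (ξ : ℝ → E d) (T : ℝ) : Prop :=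
  0 ≤ T ∧ LocallyLipschitzOn (Icc 0 T) ξ ∧
    ∀ᵐ t ∂(volume.restrict (Icc 0 T)), ∃ w : E d, HasDerivAt ξ w t ∧
      (w = 0 ∨ ∃ l : Line d, ∃ v : ℝ, (l, v) ∈ M ∧ ‖w‖ ≤ v ∧
        l.1 = AffineSubspace.mk' (ξ t) (Submodule.span ℝ {w}))

/-- The set of time lengths of the finite-time paths from `a` to `b`. -/
def travelTimes {d : ℕ} (M : Set (Line d × ℝ)) (a b : E d) : Set ℝ :=
  {T | ∃ ξ : ℝ → E d, IsPath M ξ T ∧ ξ 0 = a ∧ ξ T = b}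

/-- `g`, restricted to `[0, T]`, is a geodesic from `a` to `b`: a path from `a` to `b` whose time
length `T` is minimal. -/
def IsGeodesic {d : ℕ} (M : Set (Line d × ℝ)) (a b : E d) (g : ℝ → E d) (T : ℝ) : Prop :=
  IsPath M g T ∧ g 0 = a ∧ g T = b ∧ ∀ T' ∈ travelTimes M a b, T ≤ T'

/-- The intersection length of the line `l` and the path `ξ : [0, T] → ℝ^d`. -/
def intersectionLength {d : ℕ} (ξ : ℝ → E d) (T : ℝ) (l : Line d) : ENNReal :=
  Measure.hausdorffMeasure 1 (l.points ∩ ξ '' Icc 0 T)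

/-- The support of the path `ξ : [0, T] → ℝ^d`: the lines of `M` with positive intersection
length with `ξ`. -/
def support {d : ℕ} (M : Set (Line d × ℝ)) (ξ : ℝ → E d) (T : ℝ) : Set (Line d) :=
  {l | (∃ v : ℝ, (l, v) ∈ M) ∧ 0 < intersectionLength ξ T l}

end PoissonRoads

end

open MeasureTheory Set Metric

namespace PoissonRoads

open Filter Topology
open scoped ENNReal NNReal

/-! ### Lipschitz curves -/

/-! Suppose that one geodesic follows a line `l` for a positive length and another does not. Let `v`
be the largest speed limit that `l` carries. Removing `(l, v)` leaves the second geodesic intact, so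
the minimal time is unchanged. Putting `l` back with a limit `q ≤ v` gains nothing, since every path
then respects the original limits; with `q > v` it gains strictly, since the first geodesic can be
sped up. Hence `v` is a threshold determined by `l` and the other marked lines (`IsCritical`,
`exists_isCritical`). Given these, the speed law has a density, so it hits the threshold with
probability zero (`markedLineMeasure_isCritical`).

"Given the other marked lines" is made precise by countably many cells: almost surely each marked
line is alone in one of them, and a single point in a cell has a law dominated by the intensity and
independent of the configuration outside (`IsPoissonProcess.ae_notMem_of_inter_eq_singleton`).

This requires a travel time that depends measurably on the configuration. `relaxedTime` is built by
countable operations from costs of chains in a dense sequence. It never exceeds the duration of a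
path in a slightly smaller ball (`IsPath.relaxedTime_le`), and by compactness it is the duration of
some path whenever it is finite (`exists_isPath_of_relaxedTime_ne_top`). -/

/-- The displacement of a Lipschitz curve is at most the integral of a bound of its speed. -/
theorem enorm_sub_le_lintegral_of_lipschitzOn {F : Type*} [NormedAddCommGroup F]
    [InnerProductSpace ℝ F] {f : ℝ → F} {a b : ℝ} (hab : a ≤ b) {K : ℝ≥0}
    (hf : LipschitzOnWith K f (Icc a b)) {φ : ℝ → ℝ≥0∞}
    (hφ : ∀ᵐ t, t ∈ Icc a b → ∃ w, HasDerivAt f w t ∧ ‖w‖ₑ ≤ φ t) :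
    ‖f b - f a‖ₑ ≤ ∫⁻ t in Icc a b, φ t := by
  by_cases h0 : f b - f a = 0
  · simp [h0]
  -- Projecting on the direction of the displacement reduces the claim to a real absolutely
  -- continuous function.
  set u : F := (‖f b - f a‖⁻¹ : ℝ) • (f b - f a) with hu
  have hn : ‖f b - f a‖ ≠ 0 := by simpa using h0
  have hu1 : ‖u‖ = 1 := by rw [hu, norm_smul, norm_inv, norm_norm, inv_mul_cancel₀ hn]
  have hlip : LipschitzOnWith (‖innerSL ℝ u‖₊ * K) (fun t => inner ℝ u (f t)) (uIcc a b) := by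
    rw [uIcc_of_le hab]
    exact (innerSL ℝ u).lipschitz.comp_lipschitzOnWith hf
  have hftc := hlip.absolutelyContinuousOnInterval.integral_deriv_eq_sub
  have hval : (inner ℝ u (f b) - inner ℝ u (f a) : ℝ) = ‖f b - f a‖ := by
    rw [← inner_sub_right, hu, real_inner_smul_left, real_inner_self_eq_norm_sq]
    field_simp
  rw [hval, intervalIntegral.integral_of_le hab, ← integral_Icc_eq_integral_Ioc] at hftc
  calc ‖f b - f a‖ₑ = ‖(‖f b - f a‖ : ℝ)‖ₑ := by simp
    _ ≤ ∫⁻ t in Icc a b, ‖deriv (fun t => (inner ℝ u (f t) : ℝ)) t‖ₑ := by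
        rw [← hftc]; exact enorm_integral_le_lintegral_enorm _
    _ ≤ ∫⁻ t in Icc a b, φ t := by
        refine lintegral_mono_ae ((ae_restrict_iff' measurableSet_Icc).2 ?_)
        filter_upwards [hφ] with t ht htab
        obtain ⟨w, hw, hle⟩ := ht htab
        have hd : HasDerivAt (fun t => (inner ℝ u (f t) : ℝ)) (inner ℝ u w) t :=
          (innerSL ℝ u).hasFDerivAt.comp_hasDerivAt t hw
        rw [hd.deriv]
        refine le_trans ?_ hle
        rw [enorm_le_iff_norm_le]
        calc ‖(inner ℝ u w : ℝ)‖ ≤ ‖u‖ * ‖w‖ := norm_inner_le_norm u w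
          _ = ‖w‖ := by rw [hu1, one_mul]

/-- Almost every point of a set of real numbers is an accumulation point of it. -/
theorem ae_accPt (A : Set ℝ) : ∀ᵐ t, t ∈ A → AccPt t (𝓟 A) := by
  -- These points form a discrete subspace of `ℝ`, countable by the Lindelöf property.
  have hc : {t | t ∈ A ∧ ¬ AccPt t (𝓟 A)}.Countable := by
    rw [← countable_coe_iff]
    have : DiscreteTopology {t | t ∈ A ∧ ¬ AccPt t (𝓟 A)} := by
      refine discreteTopology_subtype_iff'.2 ?_
      rintro t ⟨htA, ht⟩
      rw [accPt_iff_nhds] at ht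
      push Not at ht
      obtain ⟨U, hU, hUA⟩ := ht
      obtain ⟨V, hVU, hV, htV⟩ := _root_.mem_nhds_iff.1 hU
      refine ⟨V, hV, ?_⟩
      ext s
      constructor
      · rintro ⟨hs, hsA, -⟩
        exact hUA s ⟨hVU hs, hsA⟩
      · rintro rfl
        exact ⟨htV, htA, by rw [accPt_iff_nhds]; push Not; exact ⟨U, hU, hUA⟩⟩
    exact countable_of_Lindelof_of_discrete
  filter_upwards [hc.ae_notMem volume] with t ht htA
  by_contra hacc
  exact ht ⟨htA, hacc⟩

/-- At an accumulation point of the times spent in an affine subspace, the velocity is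
parallel to it. -/
theorem mem_direction_of_accPt {F : Type*} [NormedAddCommGroup F] [NormedSpace ℝ F]
    [FiniteDimensional ℝ F] {f : ℝ → F} {w : F} {t : ℝ} (hf : HasDerivAt f w t)
    {s : AffineSubspace ℝ F} (ht : f t ∈ s) {A : Set ℝ} (hA : ∀ r ∈ A, f r ∈ s)
    (hacc : AccPt t (𝓟 A)) : w ∈ s.direction := by
  have hcl : IsClosed (s.direction : Set F) := s.direction.closed_of_finiteDimensional
  have hts := hasDerivAt_iff_tendsto_slope.1 hf
  have hne : (𝓝[≠] t ⊓ 𝓟 A).NeBot := hacc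
  refine hcl.mem_of_tendsto (hts.mono_left (inf_le_left (b := 𝓟 A))) ?_
  have : ∀ᶠ r in 𝓝[≠] t ⊓ 𝓟 A, r ∈ A := mem_inf_of_right (mem_principal_self A)
  filter_upwards [this] with r hr
  rw [slope_def_module]
  exact s.direction.smul_mem _ (s.vsub_mem_direction (hA r hr) ht)

/-- A curve with non-vanishing velocity on `Z` whose image of `Z` has zero length spends no time
in `Z`. -/
theorem volume_eq_zero_of_hausdorffMeasure_image {F : Type*} [NormedAddCommGroup F]
    [NormedSpace ℝ F] [MeasurableSpace F] [BorelSpace F] {f : ℝ → F} {Z : Set ℝ}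
    (hd : ∀ t ∈ Z, ∃ w, HasDerivAt f w t ∧ w ≠ 0) (h0 : μH[1] (f '' Z) = 0) :
    volume Z = 0 := by
  set c : ℕ → ℝ := fun k => 1 / (k + 1)
  have hcpos : ∀ k, 0 < c k := fun k => by positivity
  have hclim : Tendsto c atTop (𝓝 0) := tendsto_one_div_add_atTop_nhds_zero_nat
  -- On each piece the difference quotients are at least `c k`, and the piece is shorter than the
  -- scale where this holds; so `f` is antilipschitz there and length cannot be lost.
  set W : ℕ → ℤ → Set ℝ := fun k m => {t | t ∈ Z ∧ t ∈ Ico (m * c k) ((m + 1) * c k) ∧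
    ∀ s, |s - t| < c k → c k * |s - t| ≤ ‖f s - f t‖}
  have hcover : Z ⊆ ⋃ k, ⋃ m, W k m := by
    intro t ht
    obtain ⟨w, hw, hw0⟩ := hd t ht
    have hwpos : 0 < ‖w‖ := norm_pos_iff.2 hw0
    have h1 : ∀ᶠ s in 𝓝 t, ‖f s - f t - (s - t) • w‖ ≤ ‖w‖ / 2 * ‖s - t‖ :=
      (hasDerivAt_iff_isLittleO.1 hw).def (half_pos hwpos)
    obtain ⟨ε, hε, hball⟩ := Metric.eventually_nhds_iff.1 h1
    have hk : ∀ᶠ k in atTop, c k < ε ∧ c k < ‖w‖ / 2 :=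
      ((tendsto_order.1 hclim).2 _ hε).and ((tendsto_order.1 hclim).2 _ (half_pos hwpos))
    obtain ⟨k, hkε, hkw⟩ := hk.exists
    refine mem_iUnion₂.2 ⟨k, ⌊t / c k⌋, ht, ⟨?_, ?_⟩, ?_⟩
    · exact (le_div_iff₀ (hcpos k)).1 (Int.floor_le _)
    · exact (div_lt_iff₀ (hcpos k)).1 (Int.lt_floor_add_one _)
    · intro s hs
      have h2 := hball (y := s) (by rw [Real.dist_eq]; linarith)
      have h3 : ‖(s - t) • w‖ = |s - t| * ‖w‖ := by rw [norm_smul, Real.norm_eq_abs]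
      have h4 : ‖(s - t) • w‖ ≤ ‖f s - f t‖ + ‖f s - f t - (s - t) • w‖ := by
        have := norm_sub_norm_le ((s - t) • w) (f s - f t)
        rw [norm_sub_rev ((s - t) • w)] at this
        linarith
      rw [Real.norm_eq_abs] at h2
      nlinarith [abs_nonneg (s - t)]
  refine measure_mono_null hcover (measure_iUnion_null fun k => measure_iUnion_null fun m => ?_)
  have hanti : AntilipschitzWith (c k)⁻¹.toNNReal (fun t : W k m => f t) := by
    refine AntilipschitzWith.of_le_mul_dist ?_
    rintro ⟨s, hsZ, hs, hs'⟩ ⟨t, htZ, ht, ht'⟩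
    have hst : |s - t| < c k := by
      rw [abs_lt]
      constructor <;> nlinarith [hs.1, hs.2, ht.1, ht.2]
    have h5 := ht' s hst
    rw [Real.coe_toNNReal _ (inv_pos.2 (hcpos k)).le, Subtype.dist_eq, Real.dist_eq, dist_eq_norm,
      inv_mul_eq_div, le_div_iff₀ (hcpos k), mul_comm]
    exact h5
  have h6 := hanti.le_hausdorffMeasure_image zero_le_one univ
  have h7 : μH[1] ((fun t : W k m => f t) '' univ) = 0 := by
    refine measure_mono_null ?_ h0
    rintro _ ⟨t, -, rfl⟩
    exact ⟨t, t.2.1, rfl⟩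
  rw [h7, mul_zero, nonpos_iff_eq_zero] at h6
  have h8 := (isometry_subtype_coe (s := W k m)).hausdorffMeasure_image
    (Or.inl zero_le_one) (univ : Set (W k m))
  rw [h6, image_univ, Subtype.range_coe, hausdorffMeasure_real] at h8
  exact h8

variable {d : ℕ}

/-! ### Local speed bounds and approximate travel times -/

/-- The supremum of the speed limits of the lines of `M` that hit the closed ball of centre `p` and
radius `r`. -/
noncomputable def hitSpeed (M : Set (Line d × ℝ)) (p : E d) (r : ℝ) : ℝ≥0∞ :=
  ⨆ z ∈ M, ⨆ _ : z.1 ∈ hittingSet (closedBall p r), ENNReal.ofReal z.2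

theorem le_hitSpeed {M : Set (Line d × ℝ)} {p : E d} {r : ℝ} {z : Line d × ℝ} (hz : z ∈ M)
    (hp : z.1 ∈ hittingSet (closedBall p r)) : ENNReal.ofReal z.2 ≤ hitSpeed M p r :=
  le_iSup₂_of_le z hz (le_iSup_of_le hp le_rfl)

theorem hitSpeed_le {M : Set (Line d × ℝ)} {p : E d} {r : ℝ} {c : ℝ≥0∞}
    (h : ∀ z ∈ M, z.1 ∈ hittingSet (closedBall p r) → ENNReal.ofReal z.2 ≤ c) :
    hitSpeed M p r ≤ c :=
  iSup₂_le fun z hz => iSup_le fun hp => h z hz hp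

theorem hittingSet_mono {K L : Set (E d)} (h : K ⊆ L) : hittingSet K ⊆ hittingSet L :=
  fun _ hl => hl.mono (inter_subset_inter_right _ h)

theorem hitSpeed_mono {M : Set (Line d × ℝ)} {p q : E d} {r s : ℝ}
    (h : closedBall p r ⊆ closedBall q s) : hitSpeed M p r ≤ hitSpeed M q s :=
  hitSpeed_le fun _ hz hp => le_hitSpeed hz (hittingSet_mono h hp)

theorem lt_hitSpeed_iff {M : Set (Line d × ℝ)} {p : E d} {r : ℝ} {c : ℝ≥0∞} :
    c < hitSpeed M p r ↔
      ∃ z ∈ M, z.1 ∈ hittingSet (closedBall p r) ∧ c < ENNReal.ofReal z.2 := by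
  simp only [hitSpeed, lt_iSup_iff, exists_prop]

/-- The time needed for a step from `p` to `q`, with a speed bound at scale `δ`. -/
noncomputable def stepCost (M : Set (Line d × ℝ)) (δ : ℝ) (p q : E d) : ℝ≥0∞ :=
  edist p q / (hitSpeed M p δ + ENNReal.ofReal δ)

/-- The time needed to follow the first `n` steps of a sequence of points. -/
noncomputable def chainTime (M : Set (Line d × ℝ)) (δ : ℝ) (n : ℕ) (p : ℕ → E d) : ℝ≥0∞ :=
  ∑ i ∈ Finset.range n, stepCost M δ (p i) (p (i + 1))

/-- The first `n + 1` terms of `p` form a chain of mesh at most `δ` from near `x` to near `y`,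
in the ball of radius `R`. -/
structure IsMeshChain (x y : E d) (R δ : ℝ) (n : ℕ) (p : ℕ → E d) : Prop where
  start : dist (p 0) x ≤ δ
  finish : dist (p n) y ≤ δ
  step : ∀ i < n, dist (p i) (p (i + 1)) ≤ δ
  mem_ball : ∀ i ≤ n, p i ∈ closedBall (0 : E d) R

/-- The least travel time at scale `δ` along chains of points of a countable dense set. -/
noncomputable def approxTime (M : Set (Line d × ℝ)) (x y : E d) (R δ : ℝ) : ℝ≥0∞ :=
  ⨅ (n : ℕ) (c : ℕ →₀ ℕ) (_ : IsMeshChain x y R δ n fun i => TopologicalSpace.denseSeq (E d) (c i)),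
    chainTime M δ n fun i => TopologicalSpace.denseSeq (E d) (c i)

/-- The limit of the approximate travel times as the scale tends to zero. -/
noncomputable def relaxedTime (M : Set (Line d × ℝ)) (x y : E d) (R : ℝ) : ℝ≥0∞ :=
  ⨆ k : ℕ, approxTime M x y R (1 / (k + 1))

theorem Line.isClosed_points (l : Line d) : IsClosed l.points :=
  l.1.closed_of_finiteDimensional

/-- A Lipschitz curve that respects the speed bound, up to the factor `w`, provides a chain of
cost at most the integral of `w`. -/
theorem approxTime_le {M : Set (Line d × ℝ)} {ξ : ℝ → E d} {T R δ : ℝ} (hT : 0 ≤ T) (hδ : 0 < δ)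
    (hδ1 : δ ≤ 1) {K : ℝ≥0} (hK : LipschitzOnWith K ξ (Icc 0 T))
    (hR : ∀ t ∈ Icc 0 T, ‖ξ t‖ + 1 ≤ R) {w : ℝ → ℝ≥0∞} (hw : Measurable w)
    (hξ : ∀ᵐ t, t ∈ Icc 0 T → ∃ v, HasDerivAt ξ v t ∧ ‖v‖ₑ ≤ w t * hitSpeed M (ξ t) 0) :
    approxTime M (ξ 0) (ξ T) R δ ≤ ∫⁻ t in Icc 0 T, w t := by
  obtain ⟨n, hn⟩ := exists_nat_gt (max 0 (K * T / (δ / 4)))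
  have hn0 : (0 : ℝ) < n := (le_max_left _ _).trans_lt hn
  have hKn : K * T / n ≤ δ / 4 := by
    have h1 : K * T / (δ / 4) < n := (le_max_right _ _).trans_lt hn
    rw [div_lt_iff₀ (by positivity)] at h1
    rw [div_le_iff₀ hn0]
    linarith
  set t : ℕ → ℝ := fun i => i * (T / n) with ht
  have htmono : Monotone t := fun i j hij => by
    simp only [ht]; gcongr
  have htn : t n = T := by simp only [ht]; field_simp
  have ht0 : t 0 = 0 := by simp [ht]
  have htmem : ∀ i ≤ n, t i ∈ Icc 0 T := fun i hi =>
    ⟨ht0 ▸ htmono (Nat.zero_le i), htn ▸ htmono hi⟩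
  have hclose : ∀ i < n, ∀ s ∈ Icc (t i) (t (i + 1)), dist (ξ s) (ξ (t i)) ≤ δ / 4 := by
    intro i hi s hs
    have hsT : s ∈ Icc 0 T := ⟨(htmem i hi.le).1.trans hs.1, hs.2.trans (htmem (i + 1) hi).2⟩
    refine (hK.dist_le_mul _ hsT _ (htmem i hi.le)).trans (le_trans ?_ hKn)
    rw [Real.dist_eq, abs_of_nonneg (by linarith [hs.1]), mul_div_assoc]
    gcongr
    have h2 : t (i + 1) = t i + T / n := by simp only [ht]; push_cast; ring
    linarith [hs.2]
  refine ENNReal.le_of_forall_pos_le_add fun ε hε _ => ?_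
  set η : ℝ := min (δ / 4) (δ * ε / (2 * n)) with hη
  have hηpos : 0 < η := lt_min (by positivity) (by positivity)
  have hηδ : η ≤ δ / 4 := min_le_left _ _
  have hdense : ∀ i, ∃ k, dist (TopologicalSpace.denseSeq (E d) k) (ξ (t i)) < η := fun i => by
    obtain ⟨k, hk⟩ := (TopologicalSpace.denseRange_denseSeq (E d)).exists_dist_lt (ξ (t i)) hηpos
    exact ⟨k, by rwa [dist_comm]⟩
  choose c₀ hc₀ using hdense
  -- Finite support keeps the infimum in `approxTime` countable, which its measurability needs.
  set c : ℕ →₀ ℕ := Finsupp.onFinset (Finset.range (n + 1)) (fun i => if i ≤ n then c₀ i else 0)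
    (fun i hi => by
      by_contra h
      rw [Finset.mem_range, not_lt] at h
      exact hi (if_neg (by omega))) with hc
  set p : ℕ → E d := fun i => TopologicalSpace.denseSeq (E d) (c i) with hp
  have hpt : ∀ i ≤ n, dist (p i) (ξ (t i)) < η := by
    intro i hi
    simp only [hp, hc, Finsupp.onFinset_apply, if_pos hi]
    exact hc₀ i
  have hchain : IsMeshChain (ξ 0) (ξ T) R δ n p := by
    refine ⟨?_, ?_, ?_, ?_⟩
    · have := hpt 0 (Nat.zero_le n)
      rw [ht0] at this
      linarith
    · have := hpt n le_rfl
      rw [htn] at this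
      linarith
    · intro i hi
      have h1 := hpt i hi.le
      have h2 := hpt (i + 1) hi
      have h3 := hclose i hi (t (i + 1)) ⟨htmono (Nat.le_succ i), le_rfl⟩
      have h4 := dist_triangle4_right (p i) (p (i + 1)) (ξ (t i)) (ξ (t (i + 1)))
      rw [dist_comm] at h3
      linarith
    · intro i hi
      have h1 := hpt i hi
      have h2 := hR _ (htmem i hi)
      rw [mem_closedBall_zero_iff]
      rw [dist_eq_norm] at h1
      have h3 := norm_sub_norm_le (p i) (ξ (t i))
      linarith
  refine (iInf_le_of_le n (iInf_le_of_le c (iInf_le_of_le hchain le_rfl))).trans ?_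
  have hstep : ∀ i ∈ Finset.range n, stepCost M δ (p i) (p (i + 1))
      ≤ (∫⁻ s in Ioc (t i) (t (i + 1)), w s) + ENNReal.ofReal (2 * η / δ) := by
    intro i hi
    rw [Finset.mem_range] at hi
    have hle : t i ≤ t (i + 1) := htmono (Nat.le_succ i)
    have hsub : Icc (t i) (t (i + 1)) ⊆ Icc 0 T := fun s hs =>
      ⟨(htmem i hi.le).1.trans hs.1, hs.2.trans (htmem (i + 1) hi).2⟩
    have hinc : ‖ξ (t (i + 1)) - ξ (t i)‖ₑ
        ≤ ∫⁻ s in Icc (t i) (t (i + 1)), hitSpeed M (p i) δ * w s := by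
      refine enorm_sub_le_lintegral_of_lipschitzOn hle (hK.mono hsub) ?_
      filter_upwards [hξ] with s hs hsI
      obtain ⟨v, hv, hvle⟩ := hs (hsub hsI)
      refine ⟨v, hv, hvle.trans ?_⟩
      rw [mul_comm]
      gcongr
      refine hitSpeed_mono ?_
      refine closedBall_subset_closedBall' ?_
      have h1 := hpt i hi.le
      have h2 := hclose i hi s hsI
      have h3 := dist_triangle_right (ξ s) (p i) (ξ (t i))
      linarith
    rw [lintegral_const_mul _ hw, restrict_Ioc_eq_restrict_Icc.symm] at hinc
    refine ENNReal.div_le_of_le_mul ?_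
    have h1 : edist (p i) (p (i + 1)) ≤ ENNReal.ofReal (2 * η)
        + ‖ξ (t (i + 1)) - ξ (t i)‖ₑ := by
      rw [← edist_eq_enorm_sub, edist_dist, edist_dist,
        ← ENNReal.ofReal_add (by positivity) dist_nonneg]
      refine ENNReal.ofReal_le_ofReal ?_
      have h1 := hpt i hi.le
      have h2 := hpt (i + 1) hi
      have h4 := dist_triangle4_right (p i) (p (i + 1)) (ξ (t i)) (ξ (t (i + 1)))
      rw [dist_comm (ξ (t i))] at h4
      linarith
    -- The summand `δ` in the denominator of `stepCost` absorbs the rounding to the dense sequence.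
    have h2 : ENNReal.ofReal (2 * η) = ENNReal.ofReal (2 * η / δ) * ENNReal.ofReal δ := by
      rw [← ENNReal.ofReal_mul (by positivity)]
      congr 1
      field_simp
    calc edist (p i) (p (i + 1))
        ≤ ENNReal.ofReal (2 * η / δ) * ENNReal.ofReal δ
          + hitSpeed M (p i) δ * ∫⁻ s in Ioc (t i) (t (i + 1)), w s := by
          rw [← h2]; exact h1.trans (by gcongr)
      _ ≤ ((∫⁻ s in Ioc (t i) (t (i + 1)), w s) + ENNReal.ofReal (2 * η / δ)) *
          (hitSpeed M (p i) δ + ENNReal.ofReal δ) := by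
          rw [add_mul, add_comm]
          refine add_le_add ?_ ?_
          · rw [mul_comm]; gcongr; exact le_self_add
          · gcongr; exact le_add_self
  have hsum : ∑ i ∈ Finset.range n, ∫⁻ s in Ioc (t i) (t (i + 1)), w s
      = ∫⁻ s in Icc 0 T, w s := by
    have h1 : ∀ m, ∑ i ∈ Finset.range m, ∫⁻ s in Ioc (t i) (t (i + 1)), w s
        = ∫⁻ s in Ioc (t 0) (t m), w s := by
      intro m
      induction m with
      | zero => simp
      | succ m ih =>
        rw [Finset.sum_range_succ, ih, ← lintegral_union measurableSet_Ioc,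
          Ioc_union_Ioc_eq_Ioc (htmono (Nat.zero_le m)) (htmono (Nat.le_succ m))]
        exact Ioc_disjoint_Ioc_of_le le_rfl
    rw [h1 n, ht0, htn, restrict_Ioc_eq_restrict_Icc]
  calc chainTime M δ n p
      ≤ ∑ i ∈ Finset.range n,
        ((∫⁻ s in Ioc (t i) (t (i + 1)), w s) + ENNReal.ofReal (2 * η / δ)) :=
        Finset.sum_le_sum hstep
    _ = (∫⁻ s in Icc 0 T, w s) + n * ENNReal.ofReal (2 * η / δ) := by
        rw [Finset.sum_add_distrib, hsum]; simp
    _ ≤ (∫⁻ s in Icc 0 T, w s) + ε := by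
        gcongr
        rw [← ENNReal.ofReal_natCast, ← ENNReal.ofReal_mul hn0.le, ← ENNReal.ofReal_coe_nnreal]
        refine ENNReal.ofReal_le_ofReal ?_
        have : η ≤ δ * ε / (2 * n) := min_le_right _ _
        rw [le_div_iff₀ (by positivity)] at this
        rw [← mul_div_assoc, div_le_iff₀ hδ]
        linarith

theorem relaxedTime_le {M : Set (Line d × ℝ)} {ξ : ℝ → E d} {T R : ℝ} (hT : 0 ≤ T)
    {K : ℝ≥0} (hK : LipschitzOnWith K ξ (Icc 0 T))
    (hR : ∀ t ∈ Icc 0 T, ‖ξ t‖ + 1 ≤ R) {w : ℝ → ℝ≥0∞} (hw : Measurable w)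
    (hξ : ∀ᵐ t, t ∈ Icc 0 T → ∃ v, HasDerivAt ξ v t ∧ ‖v‖ₑ ≤ w t * hitSpeed M (ξ t) 0) :
    relaxedTime M (ξ 0) (ξ T) R ≤ ∫⁻ t in Icc 0 T, w t :=
  iSup_le fun k => approxTime_le hT (by positivity)
    (div_le_one_of_le₀ (by linarith [Nat.cast_nonneg (α := ℝ) k]) (by positivity)) hK hR hw hξ

/-! ### Compactness of paths in a locally finite configuration -/

/-- Only finitely many marked lines of `M` hit a given ball with a speed limit above a given
positive threshold. -/
def IsLocFinite (M : Set (Line d × ℝ)) : Prop :=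
  ∀ R a : ℝ, 0 < a → {z | z ∈ M ∧ z.1 ∈ hittingSet (closedBall 0 R) ∧ a < z.2}.Finite

theorem IsLocFinite.mono {M N : Set (Line d × ℝ)} (hM : IsLocFinite M) (h : N ⊆ M) :
    IsLocFinite N := fun R a ha => (hM R a ha).subset fun _ hz => ⟨h hz.1, hz.2⟩

theorem IsLocFinite.insert {M : Set (Line d × ℝ)} (hM : IsLocFinite M) (z : Line d × ℝ) :
    IsLocFinite (insert z M) := fun R a ha => ((hM R a ha).insert z).subset fun _ hz =>
  hz.1.imp id fun h => ⟨h, hz.2⟩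

theorem mem_closedBall_zero_of_mem {p q : E d} {r : ℝ} (h : q ∈ closedBall p r) :
    q ∈ closedBall (0 : E d) (‖p‖ + r) :=
  closedBall_subset_closedBall' (by rw [dist_zero_right, add_comm]) h

theorem IsLocFinite.exists_hitSpeed_le {M : Set (Line d × ℝ)} (hM : IsLocFinite M) (R : ℝ) :
    ∃ L : ℝ≥0, ∀ p ∈ closedBall (0 : E d) R, ∀ r ≤ 1, hitSpeed M p r ≤ L := by
  obtain ⟨b, hb⟩ := ((hM (R + 1) 1 one_pos).image Prod.snd).bddAbove
  refine ⟨(max b 1).toNNReal, fun p hp r hr => hitSpeed_le fun z hz hzp => ?_⟩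
  change _ ≤ ENNReal.ofReal (max b 1)
  refine ENNReal.ofReal_le_ofReal ?_
  rcases le_or_gt z.2 1 with h | h
  · exact h.trans (le_max_right _ _)
  · refine (hb ⟨z, ⟨hz, hittingSet_mono (fun q hq => ?_) hzp, h⟩, rfl⟩).trans (le_max_left _ _)
    refine closedBall_subset_closedBall ?_ (mem_closedBall_zero_of_mem hq)
    rw [mem_closedBall_zero_iff] at hp
    linarith

/-- The speed limit is upper semicontinuous. -/
theorem IsLocFinite.exists_hitSpeed_le_of_lt {M : Set (Line d × ℝ)} (hM : IsLocFinite M) {q : E d}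
    {c : ℝ} (hc : 0 < c) (h : ∀ z ∈ M, q ∈ z.1.points → z.2 < c) :
    ∃ r > 0, ∃ κ, 0 ≤ κ ∧ κ < c ∧ hitSpeed M q r ≤ ENNReal.ofReal κ := by
  -- Only finitely many lines near `q` are faster than `c / 2`. A small `r` excludes those that miss
  -- `q`, and the others have limits below a common `κ < c`.
  have hfin := hM (‖q‖ + 1) (c / 2) (half_pos hc)
  have h1 : ∀ᶠ κ in 𝓝[<] c, ∀ z ∈ {z | z ∈ M ∧ z.1 ∈ hittingSet (closedBall 0 (‖q‖ + 1)) ∧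
      c / 2 < z.2}, z.2 < c → z.2 ≤ κ := by
    rw [eventually_all_finite hfin]
    intro z _
    by_cases hzc : z.2 < c
    · filter_upwards [Ioo_mem_nhdsLT hzc] with κ hκ _ using hκ.1.le
    · exact Eventually.of_forall fun _ h => absurd h hzc
  have h2 : ∀ᶠ r in 𝓝[>] (0 : ℝ), ∀ z ∈ {z | z ∈ M ∧ z.1 ∈ hittingSet (closedBall 0 (‖q‖ + 1)) ∧
      c / 2 < z.2}, z.1 ∈ hittingSet (closedBall q r) → q ∈ z.1.points := by
    rw [eventually_all_finite hfin]
    intro z _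
    by_cases hzq : q ∈ z.1.points
    · exact Eventually.of_forall fun _ _ => hzq
    · obtain ⟨ε, hε, hball⟩ := Metric.isOpen_iff.1 z.1.isClosed_points.isOpen_compl q hzq
      filter_upwards [Ioo_mem_nhdsGT hε] with r hr hz
      obtain ⟨p, hp, hpr⟩ := hz
      exact absurd hp (hball (closedBall_subset_ball hr.2 hpr))
  obtain ⟨κ, hκ, hκc⟩ := (h1.and (Ioo_mem_nhdsLT (half_lt_self hc))).exists
  obtain ⟨r, hr, hr1⟩ := (h2.and (Ioo_mem_nhdsGT one_pos)).exists
  refine ⟨r, hr1.1, κ, (half_pos hc).le.trans hκc.1.le, hκc.2, hitSpeed_le fun z hz hzr => ?_⟩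
  refine ENNReal.ofReal_le_ofReal ?_
  rcases le_or_gt z.2 (c / 2) with h | hzc
  · exact h.trans hκc.1.le
  · have hz' : z ∈ {z | z ∈ M ∧ z.1 ∈ hittingSet (closedBall 0 (‖q‖ + 1)) ∧ c / 2 < z.2} := by
      refine ⟨hz, hittingSet_mono (fun p hp => ?_) hzr, hzc⟩
      exact closedBall_subset_closedBall (by linarith [hr1.2]) (mem_closedBall_zero_of_mem hp)
    exact hκ z hz' (h z hz (hr z hz' hzr))

theorem Line.eq_mk' (l : Line d) {q w : E d} (hq : q ∈ l.1) (hw : w ∈ l.1.direction)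
    (hw0 : w ≠ 0) : l.1 = AffineSubspace.mk' q (Submodule.span ℝ {w}) := by
  have h1 : Submodule.span ℝ {w} = l.1.direction := by
    refine Submodule.eq_of_le_of_finrank_eq ?_ ?_
    · rwa [Submodule.span_singleton_le_iff_mem]
    · rw [l.2.2, finrank_span_singleton hw0]
  rw [h1, AffineSubspace.mk'_eq hq]

/-! ### Chains read as step functions of time -/

/-- The position at time `t` of a traveller that stays at `p i` from time `s i` to `s (i + 1)` and
stops at `p n`. -/
noncomputable def stepPath {F : Type*} (p : ℕ → F) (s : ℕ → ℝ) (n : ℕ) (t : ℝ) : F :=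
  open Classical in p (Nat.findGreatest (fun i => s i ≤ t) n)

theorem dist_le_of_steps {F : Type*} [PseudoMetricSpace F] {p : ℕ → F} {s : ℕ → ℝ} {B : ℝ}
    {i j : ℕ} (hij : i ≤ j)
    (h : ∀ m, i ≤ m → m < j → dist (p m) (p (m + 1)) ≤ B * (s (m + 1) - s m)) :
    dist (p i) (p j) ≤ B * (s j - s i) := by
  induction j, hij using Nat.le_induction with
  | base => simp
  | succ j hij ih =>
    have h1 := ih fun m hm hmj => h m hm (by omega)
    have h2 := h j hij (by omega)
    have h3 := dist_triangle (p i) (p j) (p (j + 1))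
    linarith

-- The step in progress at time `t` costs at most `δ` in distance; the later ones up to `k` take
-- place within `[t, t']`, so the bound `B` is needed on them only. Intermediate `k` serve to locate
-- the traveller before a sharper speed bound is applied.
open Classical in
theorem dist_stepPath_le {F : Type*} [PseudoMetricSpace F] {p : ℕ → F} {s : ℕ → ℝ} {n : ℕ}
    {δ B : ℝ} (hδ : 0 ≤ δ) (hB : 0 ≤ B) (hp : ∀ i < n, dist (p i) (p (i + 1)) ≤ δ)
    (hs : MonotoneOn s (Iic n)) {t t' : ℝ} (htt : t ≤ t') {k : ℕ}
    (hk : Nat.findGreatest (fun i => s i ≤ t) n ≤ k)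
    (hk' : k ≤ Nat.findGreatest (fun i => s i ≤ t') n)
    (h : ∀ m, Nat.findGreatest (fun i => s i ≤ t) n < m → m < k →
      dist (p m) (p (m + 1)) ≤ B * (s (m + 1) - s m)) :
    dist (stepPath p s n t) (p k) ≤ δ + B * (t' - t) := by
  set i := Nat.findGreatest (fun i => s i ≤ t) n with hi
  set j := Nat.findGreatest (fun i => s i ≤ t') n with hj
  have hBt : 0 ≤ B * (t' - t) := mul_nonneg hB (by linarith)
  change dist (p i) (p k) ≤ _
  rcases hk.eq_or_lt with hik | hik
  · rw [hik, dist_self]; positivity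
  have hjn : j ≤ n := Nat.findGreatest_le n
  have h1 : t < s (i + 1) := by
    by_contra! hcon
    exact Nat.findGreatest_is_greatest (P := fun i => s i ≤ t) (n := n) (k := i + 1)
      (Nat.lt_succ_self i) (by omega) hcon
  have h2 : s j ≤ t' :=
    Nat.findGreatest_of_ne_zero (P := fun i => s i ≤ t') (n := n) hj.symm (by omega)
  have h3 : s k ≤ s j := hs (by simp; omega) (by simpa using hjn) hk'
  have h4 := dist_le_of_steps (i := i + 1) (j := k) hik fun m hm hmk => h m (by omega) hmk
  have h5 := hp i (by omega)
  have h6 := dist_triangle (p i) (p (i + 1)) (p k)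
  have h7 : B * (s k - s (i + 1)) ≤ B * (t' - t) := by gcongr; linarith
  linarith

open Classical in
theorem stepPath_mem {F : Type*} {p : ℕ → F} {s : ℕ → ℝ} {n : ℕ} {S : Set F}
    (h : ∀ i ≤ n, p i ∈ S) (t : ℝ) : stepPath p s n t ∈ S := h _ (Nat.findGreatest_le n)

theorem chainTime_mono {M : Set (Line d × ℝ)} {δ : ℝ} {p : ℕ → E d} :
    Monotone fun n => chainTime M δ n p := fun _ _ h =>
  Finset.sum_le_sum_of_subset (Finset.range_mono h)

theorem dist_le_mul_chainTime_sub {M : Set (Line d × ℝ)} {δ B : ℝ} (hδ : 0 < δ) {p : ℕ → E d}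
    {n m : ℕ} (hm : m < n) (hfin : chainTime M δ n p ≠ ⊤) (hB : 0 ≤ B)
    (h : hitSpeed M (p m) δ + ENNReal.ofReal δ ≤ ENNReal.ofReal B) :
    dist (p m) (p (m + 1))
      ≤ B * ((chainTime M δ (m + 1) p).toReal - (chainTime M δ m p).toReal) := by
  have h1 : chainTime M δ (m + 1) p = chainTime M δ m p + stepCost M δ (p m) (p (m + 1)) :=
    Finset.sum_range_succ _ _
  have hf1 : chainTime M δ (m + 1) p ≠ ⊤ := ne_top_of_le_ne_top hfin (chainTime_mono hm)
  have hf : chainTime M δ m p ≠ ⊤ := ne_top_of_le_ne_top hfin (chainTime_mono hm.le)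
  have hc : stepCost M δ (p m) (p (m + 1)) ≠ ⊤ := by
    rw [h1] at hf1
    exact ne_top_of_le_ne_top hf1 le_add_self
  rw [h1, ENNReal.toReal_add hf hc, add_sub_cancel_left]
  have hpos : hitSpeed M (p m) δ + ENNReal.ofReal δ ≠ 0 :=
    ((ENNReal.ofReal_pos.2 hδ).trans_le le_add_self).ne'
  have h2 : edist (p m) (p (m + 1)) ≤ ENNReal.ofReal B * stepCost M δ (p m) (p (m + 1)) := by
    calc edist (p m) (p (m + 1))
        = (hitSpeed M (p m) δ + ENNReal.ofReal δ) * stepCost M δ (p m) (p (m + 1)) :=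
          (ENNReal.mul_div_cancel hpos (ne_top_of_le_ne_top ENNReal.ofReal_ne_top h)).symm
      _ ≤ _ := by gcongr
  have h3 := ENNReal.toReal_mono (ENNReal.mul_ne_top ENNReal.ofReal_ne_top hc) h2
  rwa [ENNReal.toReal_mul, ENNReal.toReal_ofReal hB, edist_dist,
    ENNReal.toReal_ofReal dist_nonneg] at h3

/-- Chains of cost close to the relaxed time, as step functions of time. -/
theorem exists_chain_of_relaxedTime_ne_top {M : Set (Line d × ℝ)} {x y : E d} {R : ℝ}
    (h : relaxedTime M x y R ≠ ⊤) (k : ℕ) :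
    ∃ (n : ℕ) (p : ℕ → E d) (s : ℕ → ℝ), IsMeshChain x y R (1 / (k + 1)) n p ∧
      MonotoneOn s (Iic n) ∧ s 0 = 0 ∧ s n ≤ (relaxedTime M x y R).toReal + 1 / (k + 1) ∧
      ∀ m < n, ∀ B, 0 ≤ B → hitSpeed M (p m) (1 / (k + 1)) + ENNReal.ofReal (1 / (k + 1)) ≤
        ENNReal.ofReal B → dist (p m) (p (m + 1)) ≤ B * (s (m + 1) - s m) := by
  have hδ : (0 : ℝ) < 1 / (k + 1) := by positivity
  have h1 : approxTime M x y R (1 / (k + 1))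
      < relaxedTime M x y R + ENNReal.ofReal (1 / (k + 1)) :=
    (le_iSup (fun k : ℕ => approxTime M x y R (1 / (k + 1))) k).trans_lt
      (ENNReal.lt_add_right h (by simpa using hδ))
  simp only [approxTime, iInf_lt_iff] at h1
  obtain ⟨n, c, hc, hlt⟩ := h1
  generalize (fun i => TopologicalSpace.denseSeq (E d) (c i)) = q at hc hlt
  have hfin := hlt.ne_top
  refine ⟨n, q, fun i => (chainTime M (1 / (k + 1)) i q).toReal, hc, ?_, ?_, ?_, ?_⟩
  · intro i hi j hj hij
    exact ENNReal.toReal_mono (ne_top_of_le_ne_top hfin (chainTime_mono hj)) (chainTime_mono hij)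
  · simp [chainTime]
  · have h2 := ENNReal.toReal_mono (ENNReal.add_ne_top.2 ⟨h, ENNReal.ofReal_ne_top⟩) hlt.le
    rwa [ENNReal.toReal_add h ENNReal.ofReal_ne_top, ENNReal.toReal_ofReal hδ.le] at h2
  · intro m hm B hB hle
    exact dist_le_mul_chainTime_sub hδ hm hfin hB hle

/-- A Lipschitz curve with velocity bounded by the speed limits is a path. -/
theorem isPath_of_lipschitzWith {M : Set (Line d × ℝ)} (hM : IsLocFinite M) {ξ : ℝ → E d} {T : ℝ}
    (hT : 0 ≤ T) {L : ℝ≥0} (hL : LipschitzWith L ξ) {R : ℝ} (hR : ∀ t, ξ t ∈ closedBall 0 R)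
    (h : ∀ t w, HasDerivAt ξ w t → w ≠ 0 → ∃ z ∈ M, ξ t ∈ z.1.points ∧ ‖w‖ ≤ z.2) :
    IsPath M ξ T := by
  refine ⟨hT, hL.locallyLipschitz.locallyLipschitzOn, ae_restrict_of_ae ?_⟩
  have hcount : {z | z ∈ M ∧ z.1 ∈ hittingSet (closedBall (0 : E d) R) ∧ 0 < z.2}.Countable := by
    have : {z | z ∈ M ∧ z.1 ∈ hittingSet (closedBall (0 : E d) R) ∧ 0 < z.2} ⊆
        ⋃ k : ℕ, {z | z ∈ M ∧ z.1 ∈ hittingSet (closedBall (0 : E d) R) ∧ 1 / ((k : ℝ) + 1) < z.2} := by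
      rintro z ⟨hz, hzR, hz0⟩
      obtain ⟨k, hk⟩ := exists_nat_one_div_lt hz0
      exact mem_iUnion.2 ⟨k, hz, hzR, hk⟩
    exact (countable_iUnion fun k => (hM R _ (by positivity)).countable).mono this
  -- As countably many lines matter, one null set of times serves for all of them; outside it the
  -- velocity is parallel to every such line through the current point.
  have hacc : ∀ᵐ t, ∀ z ∈ {z | z ∈ M ∧ z.1 ∈ hittingSet (closedBall (0 : E d) R) ∧ 0 < z.2},
      ξ t ∈ z.1.points → AccPt t (𝓟 {r | ξ r ∈ z.1.points}) := by
    rw [ae_ball_iff hcount]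
    exact fun z _ => ae_accPt {r | ξ r ∈ z.1.points}
  filter_upwards [hL.ae_differentiableAt, hacc] with t ht htacc
  refine ⟨deriv ξ t, ht.hasDerivAt, ?_⟩
  by_cases hw : deriv ξ t = 0
  · exact Or.inl hw
  obtain ⟨z, hz, htz, hle⟩ := h t _ ht.hasDerivAt hw
  have hz0 : 0 < z.2 := (norm_pos_iff.2 hw).trans_le hle
  refine Or.inr ⟨z.1, z.2, hz, hle, z.1.eq_mk' htz ?_ hw⟩
  exact mem_direction_of_accPt ht.hasDerivAt htz (fun r hr => hr)
    (htacc z ⟨hz, ⟨ξ t, htz, hR t⟩, hz0⟩ htz)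

/-- In a locally finite configuration, a finite relaxed time is the time length of a path. -/
theorem exists_isPath_of_relaxedTime_ne_top {M : Set (Line d × ℝ)} (hM : IsLocFinite M)
    {x y : E d} {R : ℝ} (h : relaxedTime M x y R ≠ ⊤) :
    ∃ ξ : ℝ → E d, IsPath M ξ (relaxedTime M x y R).toReal ∧ ξ 0 = x ∧
      ξ (relaxedTime M x y R).toReal = y := by
  classical
  choose n p s hchain hs hs0 hsn hstep using exists_chain_of_relaxedTime_ne_top h
  set τ := (relaxedTime M x y R).toReal with hτ
  set δ : ℕ → ℝ := fun k => 1 / (k + 1) with hδ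
  have hδ0 : ∀ k, 0 < δ k := fun k => by positivity
  have hδ1 : ∀ k, δ k ≤ 1 := fun k =>
    div_le_one_of_le₀ (by linarith [Nat.cast_nonneg (α := ℝ) k]) (by positivity)
  have hδlim : Tendsto δ (hyperfilter ℕ) (𝓝 0) :=
    tendsto_one_div_add_atTop_nhds_zero_nat.mono_left
      (Nat.cofinite_eq_atTop ▸ hyperfilter_le_cofinite)
  obtain ⟨L₀, hL₀⟩ := hM.exists_hitSpeed_le R
  set L : ℝ≥0 := L₀ + 1 with hLdef
  have hLstep : ∀ k, ∀ m < n k,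
      dist (p k m) (p k (m + 1)) ≤ L * (s k (m + 1) - s k m) := by
    intro k m hm
    refine hstep k m hm L L.2 ?_
    rw [ENNReal.ofReal_coe_nnreal, hLdef, ENNReal.coe_add]
    exact add_le_add (hL₀ _ ((hchain k).mem_ball m hm.le) _ (hδ1 k))
      (ENNReal.ofReal_le_one.2 (hδ1 k))
  set f : ℕ → ℝ → E d := fun k => stepPath (p k) (s k) (n k) with hf
  have hfmem : ∀ k t, f k t ∈ closedBall (0 : E d) R := fun k t =>
    stepPath_mem (hchain k).mem_ball t
  have hidx : ∀ k t, Nat.findGreatest (fun i => s k i ≤ t) (n k) ≤ n k := fun k t =>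
    Nat.findGreatest_le _
  have hfdist : ∀ k t t', t ≤ t' → dist (f k t) (f k t') ≤ δ k + L * (t' - t) := by
    intro k t t' htt
    exact dist_stepPath_le (hδ0 k).le L.2 (hchain k).step (hs k) htt
      (Nat.findGreatest_mono_left (fun i hi => le_trans hi htt) _) le_rfl
      fun m _ hm => hLstep k m (hm.trans_le (hidx k t'))
  -- An ultrafilter limit replaces the extraction of a subsequence: it exists at every time by
  -- compactness of the ball, and the step functions are Lipschitz up to an error `δ k` that
  -- vanishes.
  have hlim : ∀ t, ∃ q, q ∈ closedBall (0 : E d) R ∧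
      Tendsto (fun k => f k t) (hyperfilter ℕ) (𝓝 q) := by
    intro t
    obtain ⟨q, hq, hle⟩ := (isCompact_closedBall (0 : E d) R).ultrafilter_le_nhds
      ((hyperfilter ℕ).map fun k => f k t)
      (le_principal_iff.2 (Ultrafilter.mem_map.2 (Eventually.of_forall fun k : ℕ => hfmem k t)))
    exact ⟨q, hq, hle⟩
  choose ξ hξR hξ using hlim
  have hξdist : ∀ t t', t ≤ t' → dist (ξ t) (ξ t') ≤ L * (t' - t) := by
    intro t t' htt
    have h1 := (hδlim.add_const (L * (t' - t) : ℝ))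
    rw [zero_add] at h1
    exact le_of_tendsto_of_tendsto' ((hξ t).dist (hξ t')) h1 fun k => hfdist k t t' htt
  have hξlip : LipschitzWith L ξ := by
    refine LipschitzWith.of_dist_le_mul fun t t' => ?_
    rcases le_total t t' with htt | htt
    · rw [Real.dist_eq, abs_sub_comm, abs_of_nonneg (by linarith)]
      exact hξdist t t' htt
    · rw [Real.dist_eq, abs_of_nonneg (by linarith), dist_comm]
      exact hξdist t' t htt
  have hzero : ∀ t < 0, ∀ k, Nat.findGreatest (fun i => s k i ≤ t) (n k) = 0 := by
    intro t ht k
    rw [Nat.findGreatest_eq_zero_iff]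
    intro i _ hi hcon
    have := hs k (by simp) (by simpa using hi) (Nat.zero_le i)
    rw [hs0 k] at this
    linarith
  -- The start is read off negative times, where the index is the default `0` of `Nat.findGreatest`;
  -- at time `0` it may already be positive.
  have hx : ξ 0 = x := by
    have h1 : ∀ t < 0, ξ t = x := by
      intro t ht
      have h2 : Tendsto (fun k => f k t) (hyperfilter ℕ) (𝓝 x) := by
        refine tendsto_iff_dist_tendsto_zero.2
          (squeeze_zero (fun _ => dist_nonneg) (fun k => ?_) hδlim)
        simp only [hf, stepPath, hzero t ht k]
        exact (hchain k).start
      exact tendsto_nhds_unique (hξ t) h2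
    have h3 : Tendsto ξ (𝓝[<] 0) (𝓝 (ξ 0)) := hξlip.continuous.continuousWithinAt
    have h4 : Tendsto ξ (𝓝[<] 0) (𝓝 x) :=
      tendsto_const_nhds.congr' (by
        filter_upwards [self_mem_nhdsWithin] with t ht using (h1 t ht).symm)
    exact tendsto_nhds_unique h3 h4
  have hy : ξ τ = y := by
    have h2 : Tendsto (fun k => f k τ) (hyperfilter ℕ) (𝓝 y) := by
      have h1 : Tendsto (fun k => δ k + L * δ k + δ k) (hyperfilter ℕ) (𝓝 0) := by
        simpa using (hδlim.add (hδlim.const_mul (L : ℝ))).add hδlim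
      refine tendsto_iff_dist_tendsto_zero.2
        (squeeze_zero (fun _ => dist_nonneg) (fun k => ?_) h1)
      -- By time `τ + δ k` the `k`-th chain has completed all its steps.
      have h3 := hfdist k τ (τ + δ k) (by linarith [hδ0 k])
      have h4 : f k (τ + δ k) = p k (n k) := by
        simp only [hf, stepPath]
        congr 1
        refine le_antisymm (hidx k _) (Nat.le_findGreatest le_rfl (hsn k))
      rw [h4, add_sub_cancel_left] at h3
      exact (dist_triangle _ _ _).trans (add_le_add h3 (hchain k).finish)
    exact tendsto_nhds_unique (hξ τ) h2
  refine ⟨ξ, isPath_of_lipschitzWith hM ENNReal.toReal_nonneg hξlip hξR ?_, hx, hy⟩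
  intro t w hw hw0
  -- If all lines through `ξ t` were slower than `‖w‖`, upper semicontinuity would bound the speed
  -- by some `κ < ‖w‖` near `ξ t`, hence also the derivative.
  by_contra! hcon
  obtain ⟨r, hr, κ, hκ0, hκ, hκM⟩ := hM.exists_hitSpeed_le_of_lt (norm_pos_iff.2 hw0)
    fun z hz hzq => hcon z hz hzq
  -- The radius `r` is spent in four quarters: the scale of `hitSpeed`, the step in progress, the
  -- displacement `L * u`, and the distance from `f k t` to its limit.
  have hlocal : ∀ u, 0 < u → L * u ≤ r / 4 → dist (ξ t) (ξ (t + u)) ≤ κ * u := by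
    intro u hu hLu
    have h1 : Tendsto (fun k => δ k + (κ + δ k) * u) (hyperfilter ℕ) (𝓝 (κ * u)) := by
      simpa using hδlim.add ((hδlim.const_add κ).mul_const u)
    refine le_of_tendsto_of_tendsto ((hξ t).dist (hξ (t + u))) h1 ?_
    have h2 : ∀ᶠ k in hyperfilter ℕ, dist (f k t) (ξ t) < r / 4 :=
      Metric.tendsto_nhds.1 (hξ t) _ (by positivity)
    have h3 : ∀ᶠ k in hyperfilter ℕ, δ k < r / 4 := hδlim.eventually_lt_const (by positivity)
    filter_upwards [h2, h3] with k hk2 hk3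
    have htu : t ≤ t + u := by linarith
    have h4 := dist_stepPath_le (B := κ + δ k) (hδ0 k).le (by linarith [hδ0 k]) (hchain k).step (hs k) htu
      (k := Nat.findGreatest (fun i => s k i ≤ t + u) (n k))
      (Nat.findGreatest_mono_left (fun i hi => le_trans hi htu) _) le_rfl ?_
    · rwa [add_sub_cancel_left] at h4
    intro m hm hm'
    refine hstep k m (hm'.trans_le (hidx k _)) _ (by linarith [hδ0 k]) ?_
    rw [ENNReal.ofReal_add hκ0 (hδ0 k).le]
    gcongr
    refine le_trans (hitSpeed_mono (closedBall_subset_closedBall' ?_)) hκM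
    have h5 := dist_stepPath_le (B := L) (hδ0 k).le L.2 (hchain k).step (hs k) htu hm.le hm'.le
      fun i _ hi => hLstep k i (by have := hidx k (t + u); omega)
    rw [add_sub_cancel_left, dist_comm] at h5
    have h6 := dist_triangle (p k m) (f k t) (ξ t)
    change δ k + _ ≤ _
    change dist (p k m) (f k t) ≤ _ at h5
    linarith
  have hslope : Tendsto (slope ξ t) (𝓝[>] t) (𝓝 w) :=
    (hasDerivAt_iff_tendsto_slope.1 hw).mono_left
      (nhdsWithin_mono t fun _ h => ne_of_gt h)
  refine absurd (le_of_tendsto hslope.norm ?_) (not_le.2 hκ)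
  have hLpos : (0 : ℝ) < L := by rw [hLdef]; positivity
  have hu : (0 : ℝ) < r / 4 / L := by positivity
  filter_upwards [Ioo_mem_nhdsGT (lt_add_of_pos_right t hu)] with t' ht'
  have h1 : 0 < t' - t := sub_pos.2 ht'.1
  have h2 := hlocal (t' - t) h1 (by
    rw [mul_comm, ← le_div_iff₀ hLpos]; linarith [ht'.2])
  rw [add_sub_cancel, dist_comm, dist_eq_norm] at h2
  rw [slope_def_module, norm_smul, norm_inv, Real.norm_eq_abs, abs_of_pos h1, inv_mul_eq_div,
    div_le_iff₀ h1]
  exact h2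

/-! ### The critical speed of a line -/

theorem IsPath.of_forall_exists_le {M N : Set (Line d × ℝ)} {ξ : ℝ → E d} {T : ℝ}
    (hξ : IsPath M ξ T) (h : ∀ z ∈ M, ∃ v, (z.1, v) ∈ N ∧ z.2 ≤ v) : IsPath N ξ T := by
  refine ⟨hξ.1, hξ.2.1, ?_⟩
  filter_upwards [hξ.2.2] with t ht
  obtain ⟨w, hw, hw'⟩ := ht
  refine ⟨w, hw, hw'.imp id ?_⟩
  rintro ⟨l, v, hlv, hwv, hl⟩
  obtain ⟨v', hv', hle⟩ := h _ hlv
  exact ⟨l, v', hv', hwv.trans hle, hl⟩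

theorem IsPath.mono {M N : Set (Line d × ℝ)} {ξ : ℝ → E d} {T : ℝ}
    (hξ : IsPath M ξ T) (h : M ⊆ N) : IsPath N ξ T :=
  hξ.of_forall_exists_le fun z hz => ⟨z.2, h hz, le_rfl⟩

theorem IsPath.exists_lipschitzOnWith {M : Set (Line d × ℝ)} {ξ : ℝ → E d} {T : ℝ}
    (hξ : IsPath M ξ T) : ∃ K : ℝ≥0, LipschitzOnWith K ξ (Icc 0 T) :=
  hξ.2.1.exists_lipschitzOnWith_of_compact isCompact_Icc

theorem Line.mem_points_of_eq_mk' {l : Line d} {q : E d} {s : Submodule ℝ (E d)}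
    (h : l.1 = AffineSubspace.mk' q s) : q ∈ l.points := by
  change q ∈ l.1
  rw [h]
  exact AffineSubspace.self_mem_mk' q s

theorem Line.mem_hittingSet_closedBall {l : Line d} {q : E d} (h : q ∈ l.points) :
    l ∈ hittingSet (closedBall q 0) := ⟨q, h, mem_closedBall_self le_rfl⟩

/-- A path that has no length in common with a line does not use it. -/
theorem IsPath.diff_singleton {M : Set (Line d × ℝ)} {ξ : ℝ → E d} {T : ℝ}
    (hξ : IsPath M ξ T) {l : Line d} (hl : intersectionLength ξ T l = 0) (v : ℝ) :
    IsPath (M \ {(l, v)}) ξ T := by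
  refine ⟨hξ.1, hξ.2.1, ?_⟩
  have h0 : volume {t | t ∈ Icc 0 T ∧ ξ t ∈ l.points ∧ ∃ w, HasDerivAt ξ w t ∧ w ≠ 0} = 0 := by
    refine volume_eq_zero_of_hausdorffMeasure_image (f := ξ) (fun t ht => ht.2.2)
      (measure_mono_null ?_ hl)
    rintro _ ⟨t, ht, rfl⟩
    exact ⟨ht.2.1, t, ht.1, rfl⟩
  have h1 := (ae_restrict_iff' measurableSet_Icc).1 hξ.2.2
  refine (ae_restrict_iff' measurableSet_Icc).2 ?_
  filter_upwards [h1, measure_eq_zero_iff_ae_notMem.1 h0] with t ht htZ htT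
  obtain ⟨w, hw, hw'⟩ := ht htT
  refine ⟨w, hw, ?_⟩
  by_cases hw0 : w = 0
  · exact Or.inl hw0
  obtain ⟨l', v', hM, hwv, hl'⟩ := hw'.resolve_left hw0
  refine Or.inr ⟨l', v', ⟨hM, fun heq => ?_⟩, hwv, hl'⟩
  obtain ⟨rfl, rfl⟩ := Prod.mk.inj heq
  exact htZ ⟨htT, Line.mem_points_of_eq_mk' hl', w, hw, hw0⟩

theorem IsPath.relaxedTime_le {M : Set (Line d × ℝ)} {ξ : ℝ → E d} {T R : ℝ}
    (hξ : IsPath M ξ T) (hR : ∀ t ∈ Icc 0 T, ‖ξ t‖ + 1 ≤ R) :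
    relaxedTime M (ξ 0) (ξ T) R ≤ ENNReal.ofReal T := by
  obtain ⟨K, hK⟩ := hξ.exists_lipschitzOnWith
  have h := PoissonRoads.relaxedTime_le (M := M) hξ.1 hK hR (w := fun _ => 1) measurable_const ?_
  · simpa using h
  filter_upwards [(ae_restrict_iff' measurableSet_Icc).1 hξ.2.2] with t ht htT
  obtain ⟨w, hw, hw'⟩ := ht htT
  refine ⟨w, hw, ?_⟩
  rcases hw' with rfl | ⟨l, v, hlv, hwv, hl⟩
  · simp
  rw [one_mul, ← ofReal_norm]
  exact (ENNReal.ofReal_le_ofReal hwv).trans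
    (le_hitSpeed hlv (Line.mem_hittingSet_closedBall (Line.mem_points_of_eq_mk' hl)))

/-- Raising the speed limit of a line that a path uses for a positive length shortens the travel
time. -/
theorem IsPath.relaxedTime_insert_lt {M : Set (Line d × ℝ)} {ξ : ℝ → E d} {T R : ℝ}
    (hξ : IsPath M ξ T) (hR : ∀ t ∈ Icc 0 T, ‖ξ t‖ + 1 ≤ R) {l : Line d} {v q : ℝ} (hv : 0 ≤ v)
    (hmax : ∀ v', (l, v') ∈ M → v' ≤ v) (hl : 0 < intersectionLength ξ T l) (hq : v < q) :
    relaxedTime (insert (l, q) (M \ {(l, v)})) (ξ 0) (ξ T) R < ENNReal.ofReal T := by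
  obtain ⟨K, hK⟩ := hξ.exists_lipschitzOnWith
  set A : Set ℝ := Icc 0 T ∩ ξ ⁻¹' l.points with hA
  have hAm : MeasurableSet A :=
    (hK.continuousOn.preimage_isClosed_of_isClosed isClosed_Icc l.isClosed_points).measurableSet
  have hA0 : volume A ≠ 0 := by
    intro h0
    have h1 := (hK.mono (inter_subset_left (t := ξ ⁻¹' l.points))).hausdorffMeasure_image_le
      zero_le_one
    rw [← hA, hausdorffMeasure_real, h0, mul_zero] at h1
    refine hl.ne' (measure_mono_null ?_ (nonpos_iff_eq_zero.1 h1))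
    rintro _ ⟨hpl, t, ht, rfl⟩
    exact ⟨t, ⟨ht, hpl⟩, rfl⟩
  have hq0 : 0 < q := hv.trans_lt hq
  have hratio : v / q < 1 := (div_lt_one hq0).2 hq
  -- A clock that runs at rate `v / q` while the path is on `l` and at rate `1` elsewhere; bounding
  -- the relaxed time by its integral avoids reparametrizing the path.
  set w : ℝ → ℝ≥0∞ := fun t => ENNReal.ofReal (v / q) + Aᶜ.indicator
    (fun _ => ENNReal.ofReal (1 - v / q)) t with hw
  have hone : ENNReal.ofReal (v / q) + ENNReal.ofReal (1 - v / q) = 1 := by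
    rw [← ENNReal.ofReal_add (by positivity) (by linarith), add_sub_cancel, ENNReal.ofReal_one]
  have hwm : Measurable w := (measurable_const.indicator hAm.compl).const_add _
  have hle : relaxedTime (insert (l, q) (M \ {(l, v)})) (ξ 0) (ξ T) R
      ≤ ∫⁻ t in Icc 0 T, w t := by
    refine PoissonRoads.relaxedTime_le hξ.1 hK hR hwm ?_
    filter_upwards [(ae_restrict_iff' measurableSet_Icc).1 hξ.2.2, ae_accPt A] with t ht hacc htT
    obtain ⟨u, hu, hu'⟩ := ht htT
    refine ⟨u, hu, ?_⟩
    by_cases hu0 : u = 0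
    · simp [hu0]
    obtain ⟨l', v', hM, huv, hl'⟩ := hu'.resolve_left hu0
    have htl' := Line.mem_points_of_eq_mk' hl'
    rw [← ofReal_norm]
    by_cases htA : t ∈ A
    -- On `A`, at almost every time of motion, the velocity is parallel to `l`; so the line followed
    -- is `l` itself, with limit at most `v`.
    · have hdir := mem_direction_of_accPt hu htA.2 (fun r hr => hr.2) (hacc htA)
      have hll' : l = l' := Subtype.ext ((l.eq_mk' htA.2 hdir hu0).trans hl'.symm)
      subst hll'
      have hwt : w t = ENNReal.ofReal (v / q) := by simp [hw, htA]
      calc ENNReal.ofReal ‖u‖ ≤ ENNReal.ofReal v := ENNReal.ofReal_le_ofReal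
            (huv.trans (hmax _ hM))
        _ = ENNReal.ofReal (v / q) * ENNReal.ofReal q := by
            rw [← ENNReal.ofReal_mul (by positivity), div_mul_cancel₀ _ hq0.ne']
        _ ≤ _ := by
            rw [hwt]
            gcongr
            exact le_hitSpeed (z := (l, q)) (mem_insert _ _)
              (Line.mem_hittingSet_closedBall htl')
    · have hwt : w t = 1 := by simp [hw, htA, hone]
      rw [hwt, one_mul]
      refine (ENNReal.ofReal_le_ofReal huv).trans (le_hitSpeed (z := (l', v'))
        (mem_insert_of_mem _ ⟨hM, fun heq => htA ⟨htT, ?_⟩⟩) (Line.mem_hittingSet_closedBall htl'))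
      obtain ⟨rfl, rfl⟩ := Prod.mk.inj heq
      exact htl'
  refine hle.trans_lt ?_
  have hAfin : volume A ≠ ⊤ := ne_top_of_le_ne_top (by simp) (measure_mono (inter_subset_left))
  have hsum : (∫⁻ t in Icc 0 T, w t) + ENNReal.ofReal (1 - v / q) * volume A
      = ENNReal.ofReal T := by
    have h1 : ENNReal.ofReal (1 - v / q) * volume A
        = ∫⁻ t in Icc 0 T, A.indicator (fun _ => ENNReal.ofReal (1 - v / q)) t := by
      rw [lintegral_indicator hAm, setLIntegral_const, Measure.restrict_apply hAm,
        inter_eq_self_of_subset_left inter_subset_left]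
    rw [h1, ← lintegral_add_left hwm]
    have h2 : ∀ t, w t + A.indicator (fun _ => ENNReal.ofReal (1 - v / q)) t = 1 := by
      intro t
      by_cases htA : t ∈ A <;> simp [hw, htA, hone]
    simp [h2]
  rw [← hsum]
  refine ENNReal.lt_add_right (ne_top_of_le_ne_top ENNReal.ofReal_ne_top
    (hsum ▸ le_self_add)) (mul_ne_zero ?_ hA0)
  simpa using hratio

/-- The speed `z.2` is the threshold above which adding the line `z.1` to the configuration `M`
shortens the travel time. -/
def IsCritical (x y : E d) (R : ℝ) (M : Set (Line d × ℝ)) (z : Line d × ℝ) : Prop :=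
  ∀ q : ℚ, relaxedTime (insert (z.1, (q : ℝ)) M) x y R < relaxedTime M x y R ↔ z.2 < q

/-- A line used by one geodesic and not by another one has a critical speed limit. -/
theorem exists_isCritical {M : Set (Line d × ℝ)} (hM : IsLocFinite M) (hpos : ∀ z ∈ M, 0 < z.2)
    {x y : E d} {g h : ℝ → E d} {S T : ℝ} (hg : IsGeodesic M x y g S) (hh : IsGeodesic M x y h T)
    {l : Line d} (hlg : l ∈ support M g S) (hlh : l ∉ support M h T) :
    ∃ v, (l, v) ∈ M ∧ ∃ R : ℕ, IsCritical x y R (M \ {(l, v)}) (l, v) := by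
  obtain ⟨⟨v₀, hv₀⟩, hlen⟩ := hlg
  have hlen' : intersectionLength h T l = 0 := by
    by_contra hne
    exact hlh ⟨⟨v₀, hv₀⟩, pos_iff_ne_zero.2 hne⟩
  -- The configuration is arbitrary here, so `l` may carry several limits; local finiteness provides
  -- a largest one.
  obtain ⟨v, hv, hmax⟩ : ∃ v, (l, v) ∈ M ∧ ∀ v', (l, v') ∈ M → v' ≤ v := by
    obtain ⟨q, hq⟩ := l.2.1
    have hfin : {v | (l, v) ∈ M ∧ v₀ / 2 < v}.Finite := by
      have h1 := (hM ‖q‖ (v₀ / 2) (half_pos (hpos _ hv₀))).image Prod.snd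
      refine h1.subset fun v hv => ⟨(l, v), ⟨hv.1, ⟨q, hq, by simp⟩, hv.2⟩, rfl⟩
    obtain ⟨v, hv, hmax⟩ := hfin.exists_maximalFor id _
      ⟨v₀, hv₀, half_lt_self (hpos _ hv₀)⟩
    refine ⟨v, hv.1, fun v' hv' => ?_⟩
    by_contra! hlt
    exact absurd (hmax (j := v') ⟨hv', hv.2.trans hlt⟩ hlt.le) (not_le.2 hlt)
  have hv0 := hpos _ hv
  obtain ⟨hgp, hg0, hgS, hgmin⟩ := hg
  obtain ⟨hhp, hh0, hhT, hhmin⟩ := hh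
  have hbdd : ∀ {f : ℝ → E d} {U : ℝ}, IsPath M f U → ∃ b, ∀ t ∈ Icc 0 U, ‖f t‖ ≤ b := by
    intro f U hf
    obtain ⟨K, hK⟩ := hf.exists_lipschitzOnWith
    exact isCompact_Icc.exists_bound_of_continuousOn hK.continuousOn
  obtain ⟨b₁, hb₁⟩ := hbdd hgp
  obtain ⟨b₂, hb₂⟩ := hbdd hhp
  -- A natural `R` leaves only countably many critical conditions to exclude.
  obtain ⟨R, hR⟩ := exists_nat_ge (max b₁ b₂ + 1)
  have hgR : ∀ t ∈ Icc 0 S, ‖g t‖ + 1 ≤ R := fun t ht => by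
    linarith [hb₁ t ht, le_max_left b₁ b₂]
  have hhR : ∀ t ∈ Icc 0 T, ‖h t‖ + 1 ≤ R := fun t ht => by
    linarith [hb₂ t ht, le_max_right b₁ b₂]
  refine ⟨v, hv, R, fun q => ?_⟩
  have hM' : IsLocFinite (M \ {(l, v)}) := hM.mono sdiff_subset
  -- Removing `(l, v)` does not change the minimal time: `h` survives it, and every remaining path
  -- was already available.
  have hle : relaxedTime (M \ {(l, v)}) x y R ≤ ENNReal.ofReal T := by
    have := (hhp.diff_singleton hlen' v).relaxedTime_le hhR
    rwa [hh0, hhT] at this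
  have hge : ENNReal.ofReal S ≤ relaxedTime (M \ {(l, v)}) x y R := by
    have hfin := ne_top_of_le_ne_top ENNReal.ofReal_ne_top hle
    obtain ⟨ξ, hξ, h0, h1⟩ := exists_isPath_of_relaxedTime_ne_top hM' hfin
    exact ENNReal.ofReal_le_of_le_toReal (hgmin _ ⟨ξ, hξ.mono sdiff_subset, h0, h1⟩)
  constructor
  · intro hlt
    by_contra! hqv
    obtain ⟨ξ, hξ, h0, h1⟩ := exists_isPath_of_relaxedTime_ne_top
      (hM'.insert (l, (q : ℝ))) hlt.ne_top
    have hξM : IsPath M ξ _ := hξ.of_forall_exists_le (by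
      rintro z (rfl | hz)
      · exact ⟨v, hv, hqv⟩
      · exact ⟨z.2, hz.1, le_rfl⟩)
    have h2 := ENNReal.ofReal_le_of_le_toReal (hhmin _ ⟨ξ, hξM, h0, h1⟩)
    exact absurd (hlt.trans_le hle) (not_lt.2 h2)
  · intro hq
    have h2 := hgp.relaxedTime_insert_lt hgR hv0.le hmax hlen hq
    rw [hg0, hgS] at h2
    exact h2.trans_le hge

/-! ### Configurations of points -/

/-- The configurations of points of `S`, with the σ-algebra generated by the void events. -/
structure Config (S : Type*) where
  /-- The set of points of the configuration. -/
  points : Set S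

/-- The event that there is no point in `B`. -/
def voidEvent {S : Type*} (B : Set S) : Set (Config S) := {M | M.points ∩ B = ∅}

instance Config.instMeasurableSpace (S : Type*) [MeasurableSpace S] : MeasurableSpace (Config S) :=
  MeasurableSpace.generateFrom {U | ∃ B : Set S, MeasurableSet B ∧ U = voidEvent B}

section Config

theorem count_eq_zero_iff {Ω S : Type*} {X : Ω → Set S} {B : Set S} {ω : Ω} :
    count X B ω = 0 ↔ X ω ∩ B = ∅ :=
  encard_eq_zero

variable {Ω S : Type*} [MeasurableSpace Ω] [MeasurableSpace S]

theorem measurableSet_voidEvent {B : Set S} (hB : MeasurableSet B) :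
    MeasurableSet (voidEvent B) :=
  MeasurableSpace.measurableSet_generateFrom ⟨B, hB, rfl⟩

/-- Avoiding two sets is avoiding their union. Hence finite measures on configurations are
determined by their total mass and their values on void events. -/
theorem isPiSystem_voidEvent :
    IsPiSystem {U : Set (Config S) | ∃ B : Set S, MeasurableSet B ∧ U = voidEvent B} := by
  rintro _ ⟨A, hA, rfl⟩ _ ⟨B, hB, rfl⟩ -
  refine ⟨A ∪ B, hA.union hB, ?_⟩
  ext M
  simp [voidEvent, inter_union_distrib_left]

theorem measurable_insert_config :
    Measurable fun q : Config S × S => Config.mk (insert q.2 q.1.points) := by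
  refine measurable_generateFrom ?_
  rintro _ ⟨B, hB, rfl⟩
  have : (fun q : Config S × S => Config.mk (insert q.2 q.1.points)) ⁻¹' voidEvent B
      = voidEvent B ×ˢ Bᶜ := by
    ext ⟨M, z⟩
    simp only [voidEvent, mem_preimage, mem_ofPred_eq, mem_prod, mem_compl_iff,
      eq_empty_iff_forall_notMem, mem_inter_iff, mem_insert_iff]
    constructor
    · exact fun h => ⟨fun s hs => h s ⟨Or.inr hs.1, hs.2⟩, fun hz => h z ⟨Or.inl rfl, hz⟩⟩
    · rintro ⟨h1, h2⟩ s ⟨rfl | hs, hsB⟩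
      · exact h2 hsB
      · exact h1 s ⟨hs, hsB⟩
  rw [this]
  exact (measurableSet_voidEvent hB).prod hB.compl

variable {X : Ω → Set S} {Λ : Measure S} {P : Measure Ω}

theorem IsPoissonProcess.measurable_diff (hX : IsPoissonProcess X Λ P) {C : Set S}
    (hC : MeasurableSet C) : Measurable fun ω => Config.mk (X ω \ C) := by
  refine measurable_generateFrom ?_
  rintro _ ⟨B, hB, rfl⟩
  have : (fun ω => Config.mk (X ω \ C)) ⁻¹' voidEvent B = count X (B \ C) ⁻¹' {0} := by
    ext ω
    simp only [voidEvent, mem_preimage, mem_ofPred_eq, mem_singleton_iff, count_eq_zero_iff]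
    rw [show (X ω \ C) ∩ B = X ω ∩ (B \ C) by ext; simp; tauto]
  rw [this]
  exact hX.measurable_count _ (hB.diff hC) (measurableSet_singleton 0)

theorem IsPoissonProcess.ae_inter_eq_empty (hX : IsPoissonProcess X Λ P) {B : Set S}
    (hB : MeasurableSet B) (h0 : Λ B = 0) : ∀ᵐ ω ∂P, X ω ∩ B = ∅ := by
  have h1 := hX.map_count B hB (by simp [h0])
  have h2 : (P.map (count X B)) {0}ᶜ = 0 := by
    rw [h1, Measure.map_apply (measurable_of_countable _) (measurableSet_singleton _).compl, h0]
    rw [show ((fun n : ℕ => (n : ℕ∞)) ⁻¹' {0}ᶜ : Set ℕ) = {0}ᶜ by ext; simp,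
      prob_compl_eq_zero_iff (measurableSet_singleton 0)]
    simp [ProbabilityTheory.poissonMeasure_singleton]
  rw [Measure.map_apply (hX.measurable_count B hB) (measurableSet_singleton _).compl] at h2
  filter_upwards [measure_eq_zero_iff_ae_notMem.1 h2] with ω hω
  simpa [count_eq_zero_iff] using hω

theorem IsPoissonProcess.ae_finite_inter (hX : IsPoissonProcess X Λ P) {B : Set S}
    (hB : MeasurableSet B) (hfin : Λ B ≠ ⊤) : ∀ᵐ ω ∂P, (X ω ∩ B).Finite := by
  have h2 : (P.map (count X B)) {⊤} = 0 := by
    rw [hX.map_count B hB hfin,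
      Measure.map_apply (measurable_of_countable _) (measurableSet_singleton _)]
    rw [show ((fun n : ℕ => (n : ℕ∞)) ⁻¹' {⊤} : Set ℕ) = ∅ by ext; simp, measure_empty]
  rw [Measure.map_apply (hX.measurable_count B hB) (measurableSet_singleton _)] at h2
  filter_upwards [measure_eq_zero_iff_ae_notMem.1 h2] with ω hω
  rw [← encard_ne_top_iff]
  exact hω

/-! ### Independence between a single point in a cell and the outside -/

/-- The points outside of `C` are independent from the event that `C` contains a single point,
located in `t`. -/
theorem IsPoissonProcess.measure_inter_single (hX : IsPoissonProcess X Λ P) {A C t : Set S}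
    (hA : MeasurableSet A) (hC : MeasurableSet C) (ht : MeasurableSet t) :
    P (count X (A \ C) ⁻¹' {0} ∩ (count X (C ∩ t) ⁻¹' {1} ∩ count X (C \ t) ⁻¹' {0}))
      = P (count X (A \ C) ⁻¹' {0}) *
        P (count X (C ∩ t) ⁻¹' {1} ∩ count X (C \ t) ⁻¹' {0}) := by
  -- Independence is assumed for sequences of sets, so the three sets are padded with empty ones.
  set B : ℕ → Set S := fun i => match i with
    | 0 => A \ C
    | 1 => C ∩ t
    | 2 => C \ t
    | _ => ∅ with hB
  have hBm : ∀ i, MeasurableSet (B i) := by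
    intro i
    match i with
    | 0 => exact hA.diff hC
    | 1 => exact hC.inter ht
    | 2 => exact hC.diff ht
    | _ + 3 => exact MeasurableSet.empty
  have hBd : Pairwise fun i j => Disjoint (B i) (B j) := by
    have h01 : Disjoint (A \ C) (C ∩ t) := disjoint_left.2 fun s hs hs' => hs.2 hs'.1
    have h02 : Disjoint (A \ C) (C \ t) := disjoint_left.2 fun s hs hs' => hs.2 hs'.1
    have h12 : Disjoint (C ∩ t) (C \ t) := disjoint_left.2 fun s hs hs' => hs'.2 hs.2
    intro i j hij
    match i, j with
    | 0, 0 | 1, 1 | 2, 2 => exact absurd rfl hij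
    | 0, 1 => exact h01
    | 1, 0 => exact h01.symm
    | 0, 2 => exact h02
    | 2, 0 => exact h02.symm
    | 1, 2 => exact h12
    | 2, 1 => exact h12.symm
    | _ + 3, _ => exact empty_disjoint _
    | 0, _ + 3 | 1, _ + 3 | 2, _ + 3 => exact disjoint_empty _
  have hind := hX.indep B hBm hBd
  have hsets : ∀ i, MeasurableSet ((fun i : ℕ => if i = 1 then ({1} : Set ℕ∞) else {0}) i) :=
    fun _ => MeasurableSet.of_discrete
  have h3 := hind.measure_inter_preimage_eq_mul {0, 1, 2} (fun i _ => hsets i)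
  have h2 := hind.measure_inter_preimage_eq_mul {1, 2} (fun i _ => hsets i)
  simp [hB] at h3 h2
  rw [h3, h2]

/-- A single point of the process in a cell `C` almost surely avoids sets of null measure that
depend on the points outside of `C`. -/
theorem IsPoissonProcess.ae_notMem_of_inter_eq_singleton [IsProbabilityMeasure P]
    (hX : IsPoissonProcess X Λ P) {C : Set S} (hC : MeasurableSet C) {B : Set (Config S × S)}
    (hB : MeasurableSet B) (h0 : ∀ M, Λ (Prod.mk M ⁻¹' B) = 0) :
    ∀ᵐ ω ∂P, ∀ z, X ω ∩ C = {z} → (Config.mk (X ω \ {z}), z) ∉ B := by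
  classical
  rcases isEmpty_or_nonempty S with hS | hS
  · exact Eventually.of_forall fun _ z => hS.elim z
  obtain ⟨s₀⟩ := hS
  set N : Set Ω := count X C ⁻¹' {1} with hN
  have hNm : MeasurableSet N := hX.measurable_count C hC (measurableSet_singleton 1)
  have hNiff : ∀ ω, ω ∈ N ↔ ∃ z, X ω ∩ C = {z} := fun ω => encard_eq_one
  set pick : Ω → S := fun ω => if h : ∃ z, X ω ∩ C = {z} then h.choose else s₀ with hpick
  have hpickeq : ∀ ω z, X ω ∩ C = {z} → pick ω = z := by
    intro ω z hz
    have h : ∃ z, X ω ∩ C = {z} := ⟨z, hz⟩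
    have h1 := h.choose_spec
    simp only [hpick, dif_pos h]
    exact (singleton_injective (hz.symm.trans h1)).symm
  have hpre : ∀ t, N ∩ pick ⁻¹' t
      = count X (C ∩ t) ⁻¹' {1} ∩ count X (C \ t) ⁻¹' {0} := by
    intro t
    ext ω
    simp only [mem_inter_iff, mem_preimage, mem_singleton_iff, count_eq_zero_iff, hNiff]
    constructor
    · rintro ⟨⟨z, hz⟩, hzt⟩
      rw [hpickeq ω z hz] at hzt
      have h1 : X ω ∩ (C ∩ t) = {z} := by
        rw [← inter_assoc, hz]; exact inter_eq_left.2 (singleton_subset_iff.2 hzt)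
      refine ⟨by rw [count, h1, encard_singleton], ?_⟩
      rw [← inter_sdiff_assoc, hz]
      exact sdiff_eq_empty.2 (singleton_subset_iff.2 hzt)
    · rintro ⟨h1, h2⟩
      obtain ⟨z, hz⟩ := encard_eq_one.1 h1
      have h3 : X ω ∩ C = {z} := by
        rw [← hz, ← inter_union_sdiff C t, inter_union_distrib_left, h2, union_empty]
        simp
      refine ⟨⟨z, h3⟩, ?_⟩
      rw [hpickeq ω z h3]
      exact (hz ▸ mem_singleton z : z ∈ X ω ∩ (C ∩ t)).2.2
  have hpickm : ∀ t, MeasurableSet t → MeasurableSet (N ∩ pick ⁻¹' t) := by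
    intro t ht
    rw [hpre]
    exact (hX.measurable_count _ (hC.inter ht) (measurableSet_singleton 1)).inter
      (hX.measurable_count _ (hC.diff ht) (measurableSet_singleton 0))
  -- Only `pick` restricted to `N` is known to be measurable; off `N` it is replaced by a constant.
  set pick' : Ω → S := N.piecewise pick fun _ => s₀ with hpick'
  have hpick'm : Measurable pick' := by
    intro t ht
    rw [hpick', piecewise_preimage]
    refine MeasurableSet.union ?_ ((measurable_const ht).diff hNm)
    rw [inter_comm]
    exact hpickm t ht
  have hpick'pre : ∀ t, pick' ⁻¹' t ∩ N = N ∩ pick ⁻¹' t := by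
    intro t
    ext ω
    by_cases h : ω ∈ N <;> simp [hpick', h]
  set Y : Ω → Config S := fun ω => Config.mk (X ω \ C) with hY
  have hYm : Measurable Y := hX.measurable_diff hC
  -- On `N` the outside configuration and the single point are independent; it is enough to test
  -- this on void events and measurable locations.
  have hprod : (P.restrict N).map (fun ω => (Y ω, pick' ω))
      = (P.map Y).prod ((P.restrict N).map pick') := by
    have := Measure.isProbabilityMeasure_map (μ := P) hYm.aemeasurable
    refine (Measure.prod_eq fun s t hs ht => ?_).symm
    rw [Measure.map_apply (hYm.prodMk hpick'm) (hs.prod ht), Measure.map_apply hpick'm ht,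
      Measure.restrict_apply (hpick'm ht), Measure.restrict_apply ((hYm.prodMk hpick'm) (hs.prod ht)),
      mk_preimage_prod, inter_assoc, hpick'pre]
    set E : Set Ω := N ∩ pick ⁻¹' t with hE
    have hEm : MeasurableSet E := hpickm t ht
    have hext : (P.restrict E).map Y = P E • P.map Y := by
      have h1 : ((P.restrict E).map Y) univ = P E := by
        rw [Measure.map_apply hYm MeasurableSet.univ]; simp
      refine ext_of_generate_finite _ rfl isPiSystem_voidEvent ?_ ?_
      · rintro _ ⟨A, hA, rfl⟩
        have h2 : Y ⁻¹' voidEvent A = count X (A \ C) ⁻¹' {0} := by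
          ext ω
          simp only [voidEvent, hY, mem_preimage, mem_ofPred_eq, mem_singleton_iff,
            count_eq_zero_iff]
          rw [show (X ω \ C) ∩ A = X ω ∩ (A \ C) by ext; simp; tauto]
        rw [Measure.map_apply hYm (measurableSet_voidEvent hA), Measure.smul_apply,
          Measure.map_apply hYm (measurableSet_voidEvent hA), h2,
          Measure.restrict_apply (hX.measurable_count _ (hA.diff hC) (measurableSet_singleton 0)),
          hE, hpre, hX.measure_inter_single hA hC ht, smul_eq_mul, mul_comm]
      · rw [h1, Measure.smul_apply, measure_univ, smul_eq_mul, mul_one]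
    have h3 := congrArg (fun m => m s) hext
    simp only [Measure.map_apply hYm hs, Measure.restrict_apply (hYm hs), Measure.smul_apply,
      smul_eq_mul] at h3
    rw [h3, Measure.map_apply hYm hs, mul_comm]
  -- Almost surely a `Λ`-null set contains no point of the process, so the single point cannot lie
  -- there.
  have hac : (P.restrict N).map pick' ≪ Λ := by
    refine Measure.AbsolutelyContinuous.mk fun t ht h => ?_
    rw [Measure.map_apply hpick'm ht, Measure.restrict_apply (hpick'm ht), hpick'pre, hpre]
    have h1 := hX.ae_inter_eq_empty (hC.inter ht) (measure_mono_null inter_subset_right h)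
    rw [measure_eq_zero_iff_ae_notMem]
    filter_upwards [h1] with ω hω hmem
    have h2 : count X (C ∩ t) ω = 1 := hmem.1
    rw [count, hω, encard_empty] at h2
    exact zero_ne_one h2
  have hnull : ((P.restrict N).map (fun ω => (Y ω, pick' ω))) B = 0 := by
    rw [hprod, Measure.measure_prod_null hB]
    exact Eventually.of_forall fun M => hac (h0 M)
  rw [Measure.map_apply (hYm.prodMk hpick'm) hB, Measure.restrict_apply ((hYm.prodMk hpick'm) hB)]
    at hnull
  filter_upwards [measure_eq_zero_iff_ae_notMem.1 hnull] with ω hω z hz hzB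
  have hωN : ω ∈ N := (hNiff ω).2 ⟨z, hz⟩
  refine hω ⟨?_, hωN⟩
  have h1 : pick' ω = z := by rw [hpick', piecewise_eq_of_mem _ _ _ hωN, hpickeq ω z hz]
  have h2 : Y ω = Config.mk (X ω \ {z}) := by
    simp only [hY]
    rw [← hz, sdiff_self_inter]
  rw [mem_preimage, h1, h2]
  exact hzB

end Config

/-! ### Measurability of the relaxed travel time -/

theorem measurableSet_hittingSet {K : Set (E d)} (hK : IsCompact K) :
    MeasurableSet (hittingSet K) :=
  MeasurableSpace.measurableSet_generateFrom ⟨K, hK, rfl⟩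

/-- A superlevel set says that some fast line hits the ball, which is the complement of a void
event. -/
theorem measurable_hitSpeed (p : E d) (r : ℝ) :
    Measurable fun M : Config (Line d × ℝ) => hitSpeed M.points p r := by
  refine measurable_of_Ioi fun c => ?_
  have hB : MeasurableSet (hittingSet (closedBall p r) ×ˢ {v : ℝ | c < ENNReal.ofReal v}) :=
    (measurableSet_hittingSet (isCompact_closedBall p r)).prod
      (measurableSet_lt measurable_const ENNReal.measurable_ofReal)
  convert (measurableSet_voidEvent hB).compl using 1
  ext M
  simp only [mem_preimage, mem_Ioi, lt_hitSpeed_iff, voidEvent, mem_compl_iff, mem_ofPred_eq,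
    ← nonempty_iff_ne_empty, ← ne_eq]
  exact ⟨fun ⟨z, hz, h1, h2⟩ => ⟨z, hz, h1, h2⟩, fun ⟨z, hz, h1, h2⟩ => ⟨z, hz, h1, h2⟩⟩

/-- All suprema and infima are countable, and the mesh conditions do not involve the configuration.
-/
theorem measurable_relaxedTime (x y : E d) (R : ℝ) :
    Measurable fun M : Config (Line d × ℝ) => relaxedTime M.points x y R := by
  refine Measurable.iSup fun k => Measurable.iInf fun n => Measurable.iInf fun c =>
    Measurable.iInf fun _ => ?_
  refine Finset.measurable_fun_sum _ fun i _ => ?_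
  exact measurable_const.div ((measurable_hitSpeed _ _).add_const _)

theorem measurableSet_isCritical (x y : E d) (R : ℝ) :
    MeasurableSet {q : Config (Line d × ℝ) × (Line d × ℝ) |
      IsCritical x y R q.1.points q.2} := by
  have hpt : ∀ q : ℚ, MeasurableSet {p : Config (Line d × ℝ) × (Line d × ℝ) |
      relaxedTime (insert (p.2.1, (q : ℝ)) p.1.points) x y R < relaxedTime p.1.points x y R ↔
        p.2.2 < q} := by
    intro q
    have h0 : Measurable fun p : Config (Line d × ℝ) × (Line d × ℝ) => (p.1, (p.2.1, (q : ℝ))) := by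
      fun_prop
    have h1 : Measurable fun p : Config (Line d × ℝ) × (Line d × ℝ) =>
        relaxedTime (insert (p.2.1, (q : ℝ)) p.1.points) x y R :=
      Measurable.comp (g := fun M : Config (Line d × ℝ) => relaxedTime M.points x y R)
        (f := fun p : Config (Line d × ℝ) × (Line d × ℝ) =>
          Config.mk (insert (p.2.1, (q : ℝ)) p.1.points))
        (measurable_relaxedTime x y R) (measurable_insert_config.comp h0)
    have h2 : Measurable fun p : Config (Line d × ℝ) × (Line d × ℝ) =>
        relaxedTime p.1.points x y R := (measurable_relaxedTime x y R).comp measurable_fst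
    have h3 := measurableSet_lt h1 h2
    have h4 : Measurable fun p : Config (Line d × ℝ) × (Line d × ℝ) => p.2.2 := by fun_prop
    have h5 := measurableSet_lt h4 (measurable_const (a := (q : ℝ)))
    exact measurableSet_setOfPred.2 ((measurableSet_setOfPred.1 h3).iff (measurableSet_setOfPred.1 h5))
  have : {q : Config (Line d × ℝ) × (Line d × ℝ) | IsCritical x y R q.1.points q.2}
      = ⋂ q : ℚ, {p : Config (Line d × ℝ) × (Line d × ℝ) |
      relaxedTime (insert (p.2.1, (q : ℝ)) p.1.points) x y R < relaxedTime p.1.points x y R ↔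
        p.2.2 < q} := by
    ext p
    simp [IsCritical]
  rw [this]
  exact MeasurableSet.iInter hpt

/-! ### The intensity measure -/

theorem speedMeasure_eq_zero {γ : ℝ} {s : Set ℝ} (h : volume (s ∩ Ioi 0) = 0) :
    speedMeasure γ s = 0 := by
  refine withDensity_absolutelyContinuous _ _ ?_
  rwa [Measure.restrict_apply' measurableSet_Ioi]

theorem speedMeasure_Ioi_ne_top {γ a : ℝ} (hγ : 1 < γ) (ha : 0 < a) :
    speedMeasure γ (Ioi a) ≠ ⊤ := by
  rw [speedMeasure, withDensity_apply _ measurableSet_Ioi, Measure.restrict_restrict measurableSet_Ioi,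
    inter_eq_left.2 (Ioi_subset_Ioi ha.le)]
  have h : IntegrableOn (fun v : ℝ => (γ - 1) * v ^ (-γ)) (Ioi a) :=
    (integrableOn_Ioi_rpow_of_lt (by linarith) ha).const_mul _
  exact h.lintegral_lt_top.ne

/-- The slab of thickness `2` over these lines lies in the ball: its points are within `R + 1`,
along the direction `u`, of a point of norm at most `R`. -/
theorem parallelLineMeasure_hittingSet_le (u : sphere (0 : E d) 1) (R : ℝ) :
    2 * parallelLineMeasure u (hittingSet (closedBall 0 R))
      ≤ volume (closedBall (0 : E d) (2 * R + 1)) := by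
  have hslab := volume_slab u (measurableSet_hittingSet (isCompact_closedBall (0 : E d) R))
  rw [volume_closedBall_span u] at hslab
  refine hslab.symm.le.trans (measure_mono ?_)
  rintro x ⟨hx, k, hk, hkR⟩
  have hu : ‖(u : E d)‖ = 1 := by simp
  have hk' : k - x ∈ Submodule.span ℝ {(u : E d)} := by
    simpa [Line.points, Line.through, AffineSubspace.mem_mk'] using hk
  obtain ⟨c, hc⟩ := Submodule.mem_span_singleton.1 hk'
  rw [mem_closedBall_zero_iff] at hkR ⊢
  have hcu : c = inner ℝ (u : E d) k - inner ℝ (u : E d) x := by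
    rw [← inner_sub_right, ← hc, inner_smul_right, real_inner_self_eq_norm_sq, hu]
    ring
  have h1 : |(inner ℝ (u : E d) k : ℝ)| ≤ ‖k‖ := by
    have := abs_real_inner_le_norm (u : E d) k
    rwa [hu, one_mul] at this
  have h2 : |c| ≤ R + 1 := by
    rw [hcu]
    exact (abs_sub _ _).trans (by linarith)
  have h3 : ‖k - x‖ = |c| := by rw [← hc, norm_smul, hu, mul_one, Real.norm_eq_abs]
  have h4 := norm_sub_norm_le x k
  rw [norm_sub_rev] at h4
  linarith

theorem lineMeasure_hittingSet_ne_top (d : ℕ) (R : ℝ) :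
    lineMeasure d (hittingSet (closedBall 0 R)) ≠ ⊤ := by
  have hm := measurableSet_hittingSet (isCompact_closedBall (0 : E d) R)
  rw [lineMeasure, Measure.smul_apply, Measure.bind_apply hm
    (measurable_parallelLineMeasure d).aemeasurable, smul_eq_mul]
  refine ENNReal.mul_ne_top ?_ ?_
  · rw [ENNReal.inv_ne_top]
    exact mul_ne_zero two_ne_zero (measure_ball_pos _ _ one_pos).ne'
  · have hle : ∀ u : sphere (0 : E d) 1, parallelLineMeasure u (hittingSet (closedBall 0 R))
        ≤ volume (closedBall (0 : E d) (2 * R + 1)) := fun u =>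
      (le_mul_of_one_le_left zero_le one_le_two).trans (parallelLineMeasure_hittingSet_le u R)
    refine ne_top_of_le_ne_top ?_ (lintegral_mono hle)
    rw [lintegral_const]
    exact ENNReal.mul_ne_top measure_closedBall_lt_top.ne (measure_ne_top _ _)

instance (γ : ℝ) : SFinite (speedMeasure γ) := by
  unfold speedMeasure
  infer_instance

/-- For fixed `M` and `l` at most one speed is critical, because two distinct ones would be
separated by a rational. A single speed has measure zero, and Fubini concludes. -/
theorem markedLineMeasure_isCritical (γ : ℝ) (x y : E d) (R : ℝ)
    (M : Config (Line d × ℝ)) :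
    markedLineMeasure d γ (Prod.mk M ⁻¹' {q : Config (Line d × ℝ) × (Line d × ℝ) |
      IsCritical x y R q.1.points q.2}) = 0 := by
  rw [markedLineMeasure, Measure.measure_prod_null
    (measurable_prodMk_left (measurableSet_isCritical x y R))]
  refine Eventually.of_forall fun l => speedMeasure_eq_zero
    (measure_mono_null inter_subset_left (Set.Subsingleton.measure_zero ?_ _))
  intro v hv v' hv'
  have h : ∀ q : ℚ, v < q ↔ v' < q := fun q => (hv q).symm.trans (hv' q)
  by_contra hne
  rcases lt_or_gt_of_ne hne with hlt | hlt
  · obtain ⟨q, h1, h2⟩ := exists_rat_btwn hlt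
    exact lt_asymm h2 ((h q).1 h1)
  · obtain ⟨q, h1, h2⟩ := exists_rat_btwn hlt
    exact lt_asymm h2 ((h q).2 h1)

/-! ### Isolating cells -/

/-- A countable family of sets that separates the marked lines. -/
def separatingSet (j : (ℕ × ℕ) × (ℚ × ℚ)) : Set (Line d × ℝ) :=
  hittingSet (closedBall (TopologicalSpace.denseSeq (E d) j.1.1) (1 / (j.1.2 + 1))) ×ˢ
    Ioo (j.2.1 : ℝ) j.2.2

/-- The marked lines that hit the ball of radius `n` with a speed limit above `1 / (n + 1)`. -/
def truncation (d n : ℕ) : Set (Line d × ℝ) :=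
  hittingSet (closedBall 0 n) ×ˢ Ioi (1 / ((n : ℝ) + 1))

/-- A countable family of cells, the finite intersections of separating sets inside the
truncations. -/
def cell (n : ℕ) (s : Finset ((ℕ × ℕ) × (ℚ × ℚ))) : Set (Line d × ℝ) :=
  truncation d n ∩ ⋂ j ∈ s, separatingSet j

theorem measurableSet_truncation (n : ℕ) : MeasurableSet (truncation d n) :=
  (measurableSet_hittingSet (isCompact_closedBall _ _)).prod measurableSet_Ioi

theorem measurableSet_cell (n : ℕ) (s : Finset ((ℕ × ℕ) × (ℚ × ℚ))) :
    MeasurableSet (cell n s : Set (Line d × ℝ)) :=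
  (measurableSet_truncation n).inter (Finset.measurableSet_biInter _ fun _ _ =>
    (measurableSet_hittingSet (isCompact_closedBall _ _)).prod measurableSet_Ioo)

theorem exists_denseSeq_closedBall {p : E d} {U : Set (E d)} (hU : U ∈ 𝓝 p) :
    ∃ i k : ℕ, p ∈ closedBall (TopologicalSpace.denseSeq (E d) i) (1 / (k + 1)) ∧
      closedBall (TopologicalSpace.denseSeq (E d) i) (1 / (k + 1)) ⊆ U := by
  obtain ⟨ε, hε, hball⟩ := Metric.mem_nhds_iff.1 hU
  obtain ⟨k, hk⟩ := exists_nat_one_div_lt (half_pos hε)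
  have hk0 : (0 : ℝ) < 1 / (k + 1) := by positivity
  obtain ⟨i, hi⟩ := (TopologicalSpace.denseRange_denseSeq (E d)).exists_dist_lt p hk0
  refine ⟨i, k, hi.le, fun q hq => hball ?_⟩
  have h1 := dist_triangle q (TopologicalSpace.denseSeq (E d) i) p
  rw [mem_closedBall] at hq
  rw [dist_comm] at hi
  rw [mem_ball]
  linarith

theorem Line.exists_mem_notMem {l l' : Line d} (h : l ≠ l') : ∃ p ∈ l.points, p ∉ l'.points := by
  by_contra! hcon
  have hle : l.1 ≤ l'.1 := hcon
  have hdir : l.1.direction = l'.1.direction :=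
    Submodule.eq_of_le_of_finrank_eq (AffineSubspace.direction_le hle) (l.2.2.trans l'.2.2.symm)
  obtain ⟨p, hp⟩ := l.2.1
  exact h (Subtype.ext (AffineSubspace.ext_of_direction_eq hdir ⟨p, hp, hle hp⟩))

/-- Distinct lines are separated by a small ball around a point of the first off the second; equal
lines with distinct speeds, by a rational interval. -/
theorem exists_separatingSet {z z' : Line d × ℝ} (h : z ≠ z') :
    ∃ j, z ∈ separatingSet j ∧ z' ∉ separatingSet j := by
  obtain ⟨l, v⟩ := z
  obtain ⟨l', v'⟩ := z'
  by_cases hl : l = l'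
  · subst hl
    have hv : v ≠ v' := fun hv => h (by rw [hv])
    obtain ⟨p, hp⟩ := l.2.1
    obtain ⟨i, k, h1, -⟩ := exists_denseSeq_closedBall (p := p) univ_mem
    rcases lt_or_gt_of_ne hv with hlt | hlt
    · obtain ⟨a, ha⟩ := exists_rat_lt v
      obtain ⟨b, hb, hb'⟩ := exists_rat_btwn hlt
      exact ⟨((i, k), (a, b)), ⟨⟨p, hp, h1⟩, ha, hb⟩, fun hz => lt_asymm hb' hz.2.2⟩
    · obtain ⟨a, ha, ha'⟩ := exists_rat_btwn hlt
      obtain ⟨b, hb⟩ := exists_rat_gt v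
      exact ⟨((i, k), (a, b)), ⟨⟨p, hp, h1⟩, ha', hb⟩, fun hz => lt_asymm ha hz.2.1⟩
  · obtain ⟨p, hp, hp'⟩ := Line.exists_mem_notMem hl
    obtain ⟨i, k, h1, h2⟩ :=
      exists_denseSeq_closedBall (l'.isClosed_points.isOpen_compl.mem_nhds hp')
    obtain ⟨a, ha⟩ := exists_rat_lt v
    obtain ⟨b, hb⟩ := exists_rat_gt v
    exact ⟨((i, k), (a, b)), ⟨⟨p, hp, h1⟩, ha, hb⟩,
      fun ⟨⟨q, hq, hqb⟩, _⟩ => h2 hqb hq⟩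

theorem exists_mem_truncation {R a : ℝ} (ha : 0 < a) :
    ∃ n, hittingSet (closedBall 0 R) ×ˢ Ioi a ⊆ truncation d n := by
  obtain ⟨m, hm⟩ := exists_nat_ge R
  obtain ⟨k, hk⟩ := exists_nat_one_div_lt ha
  refine ⟨max m k, prod_mono (hittingSet_mono (closedBall_subset_closedBall ?_))
    (Ioi_subset_Ioi (le_trans ?_ hk.le))⟩
  · exact hm.trans (by exact_mod_cast le_max_left m k)
  · exact one_div_le_one_div_of_le (by positivity) (by
      have : (k : ℝ) ≤ (max m k : ℕ) := by exact_mod_cast le_max_right m k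
      linarith)

theorem isLocFinite_of_truncation {M : Set (Line d × ℝ)}
    (h : ∀ n, (M ∩ truncation d n).Finite) : IsLocFinite M := by
  intro R a ha
  obtain ⟨n, hn⟩ := exists_mem_truncation (d := d) (R := R) ha
  exact (h n).subset fun z hz => ⟨hz.1, hn hz.2⟩

/-- A truncation around `z` contains finitely many points of `M`, and each of the others is cut away
by one separating set. -/
theorem exists_inter_cell_eq_singleton {M : Set (Line d × ℝ)}
    (h : ∀ n, (M ∩ truncation d n).Finite) {z : Line d × ℝ} (hz : z ∈ M) (hpos : 0 < z.2) :
    ∃ n s, M ∩ cell n s = {z} := by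
  obtain ⟨p, hp⟩ := z.1.2.1
  obtain ⟨n, hn⟩ := exists_mem_truncation (d := d) (R := ‖p‖) (half_pos hpos)
  have hzn : z ∈ truncation d n := hn ⟨⟨p, hp, by simp⟩, half_lt_self hpos⟩
  have hsep : ∀ z' : Line d × ℝ, ∃ j, z ∈ separatingSet j ∧ (z ≠ z' → z' ∉ separatingSet j) := by
    intro z'
    by_cases hzz : z = z'
    -- For `z' = z` any separating set containing `z` will do; comparison with a shifted speed
    -- provides one.
    · obtain ⟨j, hj, -⟩ := exists_separatingSet (z := z) (z' := (z.1, z.2 + 1))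
        fun heq => absurd (congrArg Prod.snd heq) (lt_add_one z.2).ne
      exact ⟨j, hj, fun hne => absurd hzz hne⟩
    · obtain ⟨j, hj, hj'⟩ := exists_separatingSet hzz
      exact ⟨j, hj, fun _ => hj'⟩
  choose j hj hj' using hsep
  classical
  refine ⟨n, (h n).toFinset.image j, ?_⟩
  ext z'
  simp only [cell, mem_inter_iff, mem_iInter, Finset.mem_image, Set.Finite.mem_toFinset,
    mem_singleton_iff]
  constructor
  · rintro ⟨hM, hT, hall⟩
    by_contra hne
    exact hj' z' (Ne.symm hne) (hall _ ⟨z', ⟨hM, hT⟩, rfl⟩)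
  · rintro rfl
    refine ⟨hz, hzn, ?_⟩
    rintro _ ⟨z'', -, rfl⟩
    exact hj z''

/-! ### Equality of supports, first for a configuration without critical lines, then almost surely
-/

theorem support_eq_of_not_isCritical {M : Set (Line d × ℝ)}
    (hfin : ∀ n, (M ∩ truncation d n).Finite) (hpos : ∀ z ∈ M, 0 < z.2) {x y : E d}
    (hcrit : ∀ n s, ∀ R : ℕ, ∀ z, M ∩ cell n s = {z} → ¬ IsCritical x y R (M \ {z}) z)
    {g h : ℝ → E d} {S T : ℝ} (hg : IsGeodesic M x y g S) (hh : IsGeodesic M x y h T) :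
    support M g S = support M h T := by
  have key : ∀ {g h : ℝ → E d} {S T : ℝ}, IsGeodesic M x y g S → IsGeodesic M x y h T →
      support M g S ⊆ support M h T := by
    intro g h S T hg hh l hl
    by_contra hlh
    obtain ⟨v, hv, R, hR⟩ := exists_isCritical (isLocFinite_of_truncation hfin) hpos hg hh hl hlh
    obtain ⟨n, s, hns⟩ := exists_inter_cell_eq_singleton hfin hv (hpos _ hv)
    exact hcrit n s R _ hns hR
  exact (key hg hh).antisymm (key hh hg)

end PoissonRoads

theorem mainTheorem7 (d : ℕ) (hd : 2 ≤ d) (γ : ℝ) (hγ : (d : ℝ) < γ)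
    {Ω : Type*} [MeasurableSpace Ω] (P : Measure Ω) [IsProbabilityMeasure P]
    (X : Ω → Set (PoissonRoads.Line d × ℝ))
    (hX : PoissonRoads.IsPoissonProcess X (PoissonRoads.markedLineMeasure d γ) P)
    (x y : PoissonRoads.E d) :
    ∀ᵐ ω ∂P, ∀ (g h : ℝ → PoissonRoads.E d) (S T : ℝ),
      PoissonRoads.IsGeodesic (X ω) x y g S → PoissonRoads.IsGeodesic (X ω) x y h T →
        PoissonRoads.support (X ω) g S = PoissonRoads.support (X ω) h T := by
  -- The speed measure of `Ioi a` is finite for `a > 0` because `γ > 1`.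
  have hγ1 : 1 < γ := lt_trans (by exact_mod_cast hd) hγ
  have hfin : ∀ᵐ ω ∂P, ∀ n, (X ω ∩ PoissonRoads.truncation d n).Finite := by
    refine ae_all_iff.2 fun n =>
      hX.ae_finite_inter (PoissonRoads.measurableSet_truncation n) ?_
    rw [PoissonRoads.markedLineMeasure, PoissonRoads.truncation, Measure.prod_prod]
    exact ENNReal.mul_ne_top (PoissonRoads.lineMeasure_hittingSet_ne_top d n)
      (PoissonRoads.speedMeasure_Ioi_ne_top hγ1 (by positivity))
  have hpos : ∀ᵐ ω ∂P, X ω ∩ univ ×ˢ Iic 0 = ∅ := by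
    refine hX.ae_inter_eq_empty (MeasurableSet.univ.prod measurableSet_Iic) ?_
    have h0 : PoissonRoads.speedMeasure γ (Iic 0) = 0 :=
      PoissonRoads.speedMeasure_eq_zero (by rw [Iic_inter_Ioi, Ioc_self, measure_empty])
    rw [PoissonRoads.markedLineMeasure, Measure.prod_prod, h0, mul_zero]
  have hcrit : ∀ᵐ ω ∂P, ∀ n s, ∀ R : ℕ, ∀ z, X ω ∩ PoissonRoads.cell n s = {z} →
      ¬ PoissonRoads.IsCritical x y R (X ω \ {z}) z := by
    refine ae_all_iff.2 fun n => ae_all_iff.2 fun s => ae_all_iff.2 fun R => ?_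
    exact hX.ae_notMem_of_inter_eq_singleton (PoissonRoads.measurableSet_cell n s)
      (PoissonRoads.measurableSet_isCritical x y R)
      (PoissonRoads.markedLineMeasure_isCritical γ x y R)
  filter_upwards [hfin, hpos, hcrit] with ω h1 h2 h3 g h S T hg hh
  refine PoissonRoads.support_eq_of_not_isCritical h1 (fun z hz => ?_) h3 hg hh
  by_contra! hz0
  exact (eq_empty_iff_forall_notMem.1 h2) z ⟨hz, mem_univ _, hz0⟩
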